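/- For a binary sequence $x=(x_i)_{i\ge 1}\in\{0,1\}^{\mathbb N}$ let $L_n(x)$ be the maximal length of a run of consecutive ones among $x_1,\dots,x_n$. Call $x$ typical if $\lim_{n\to\infty}L_n(x)/\log_2 n=1$, and normal if for every $m$ every block $\omega\in\{0,1\}^m$ occurs in $x$ with limiting frequency $2^{-m}$, i.e. $N(x,\omega,n)/n\to 2^{-m}$, where $N(x,\omega,n)$ is the number of occurrences of $\omega$ among the first $n$ digits of $x$. A number $y\in[0,1]$ is called typical (respectively normal) if it has a binary expansion $y=\sum_{i\ge1}x_i2^{-i}$ with $x$ typical (respectively normal). Let $\mathit{TpcN}$ and $\mathit{Normal}$ denote the sets of typical and of normal numbers in $[0,1]$. A subset of a topological space belongs to $D_2(\Pi^0_3)$ if it is of the form $P\setminus Q$ with $P,Q\in\Pi^0_3$. A subset $A$ of a space $X$ is called $D_2(\Pi^0_3)$-complete if $A\in D_2(\Pi^0_3)$, $X\setminus A\notin D_2(\Pi^0_3)$, and for every zero-dimensional Polish space $Z$ and every $B\subseteq Z$ in $D_2(\Pi^0_3)$ there is a continuous $f\colon Z\to X$ with $f^{-1}(A)=B$. Theorem.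 The sets $\mathit{TpcN}\setminus\mathit{Normal}$ and $\mathit{Normal}\setminus\mathit{TpcN}$ are nonempty, and both are $D_2(\Pi^0_3)$-complete, as subsets of $[0,1]$; the corresponding sets of binary sequences are $D_2(\Pi^0_3)$-complete as subsets of $\{0,1\}^{\mathbb N}$. Moreover, let $C$ (respectively $D$) be the set of sequences $a\in\mathbb N^{\mathbb N}$ whose even-indexed (respectively odd-indexed) terms tend to infinity. There is a single continuous map $\varphi\colon\mathbb N^{\mathbb N}\to\{0,1\}^{\mathbb N}$ such that, for every $a\in\mathbb N^{\mathbb N}$, $a\in C\setminus D$ if and only if $\varphi(a)$ is normal and not typical, and $a\in D\setminus C$ if and only if $\varphi(a)$ is typical and not normal. -/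

import Mathlib

open Filter Topology

namespace TypicalNumbers

section BorelHierarchy

variable {X : Type*} [TopologicalSpace X]

/-- `IsSigma0 n A`: the set `A` belongs to the additive Borel class `Σ⁰ₙ(X)` (`n` finite, `n ≥ 1`).
`Σ⁰₁` consists of the open sets; for `n > 1` a set is `Σ⁰ₙ` if it is a countable union of sets
that are complements of `Σ⁰` sets of lower levels. (There is no set of level `0`, so the second
rule produces nothing at levels `0` and `1`.) -/
inductive IsSigma0 : ℕ → Set X → Prop
  | of_isOpen {U : Set X} (hU : IsOpen U) : IsSigma0 1 U
  | iUnion_compl {n : ℕ} {A : Set X} {β : ℕ → ℕ} {B : ℕ → Set X} (hβ : ∀ k, β k < n)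
      (hB : ∀ k, IsSigma0 (β k) (B k)) (hA : A = ⋃ k, (B k)ᶜ) : IsSigma0 n A

/-- `IsPi0 n A`: the set `A` belongs to the multiplicative Borel class `Π⁰ₙ(X)`. -/
def IsPi0 (n : ℕ) (A : Set X) : Prop := IsSigma0 n Aᶜ

/-- `IsD2Pi0 n A`: the set `A` belongs to `D₂(Π⁰ₙ)(X)`, i.e. it is a difference of two
`Π⁰ₙ` subsets of `X`. -/
def IsD2Pi0 (n : ℕ) (A : Set X) : Prop :=
  ∃ P Q : Set X, IsPi0 n P ∧ IsPi0 n Q ∧ A = P \ Q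

/-- `D₂(Π⁰ₙ)`-completeness: `A` lies in the class, its complement does not (so `A` is not in
the dual class), and `A` is hard for the class with respect to continuous reductions from
zero-dimensional Polish spaces. -/
structure IsD2Pi0Complete (n : ℕ) (A : Set X) : Prop where
  mem : IsD2Pi0 n A
  compl_notMem : ¬ IsD2Pi0 n Aᶜ
  hard : ∀ (Z : Type) [TopologicalSpace Z] [PolishSpace Z],
    TopologicalSpace.IsTopologicalBasis {s : Set Z | IsClopen s} →
    ∀ B : Set Z, IsD2Pi0 n B → ∃ f : Z → X, Continuous f ∧ f ⁻¹' A = B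

end BorelHierarchy

/-- The largest length of a run of consecutive ones among the first `n` digits of `x`
(the digits being `x 0, x 1, …`). The set is bounded by `n` and contains `0`. -/
noncomputable def runLength (n : ℕ) (x : ℕ → Fin 2) : ℕ :=
  sSup {j : ℕ | ∃ i : ℕ, i + j ≤ n ∧ ∀ k < j, x (i + k) = 1}

/-- The number of occurrences of the block `w` of length `m` among the first `n` digits of `x`. -/
def blockCount {m : ℕ} (x : ℕ → Fin 2) (w : Fin m → Fin 2) (n : ℕ) : ℕ :=
  ((Finset.range (n + 1)).filter
    (fun i => i + m ≤ n ∧ ∀ k : Fin m, x (i + k) = w k)).card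

/-- The typical binary sequences. -/
def typicalSeq : Set (ℕ → Fin 2) :=
  {x | Tendsto (fun n : ℕ => (runLength n x : ℝ) / Real.logb 2 (n : ℝ)) atTop (𝓝 1)}

/-- The normal binary sequences. -/
def normalSeq : Set (ℕ → Fin 2) :=
  {x | ∀ (m : ℕ) (w : Fin m → Fin 2),
    Tendsto (fun n : ℕ => (blockCount x w n : ℝ) / (n : ℝ)) atTop (𝓝 (1 / 2 ^ m))}

/-- `TpcN`: the numbers in `[0,1]` having a typical binary expansion. -/
def TpcN : Set unitInterval :=
  {y | ∃ x : ℕ → Fin 2, Real.ofDigits x = (y : ℝ) ∧ x ∈ typicalSeq}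

/-- `Normal`: the numbers in `[0,1]` having a binary expansion that is normal in base two. -/
def Normal : Set unitInterval :=
  {y | ∃ x : ℕ → Fin 2, Real.ofDigits x = (y : ℝ) ∧ x ∈ normalSeq}

/-- The sequences of natural numbers whose even-indexed terms tend to infinity. -/
def evenDivergent : Set (ℕ → ℕ) :=
  {a | Tendsto (fun n => a (2 * n)) atTop atTop}

/-- The sequences of natural numbers whose odd-indexed terms tend to infinity. -/
def oddDivergent : Set (ℕ → ℕ) :=
  {a | Tendsto (fun n => a (2 * n + 1)) atTop atTop}

end TypicalNumbers

/-! Everything rests on one continuous map `encode b`, where `b` is a fixed normal sequence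
(`nonempty_normalSeq`, from the strong law of large numbers). On the dyadic stage `[2 ^ n, 2 ^ (n +
1))` it plants a run of `n + n / (a (2 * n + 1) + 1)` ones, then zeros up to a proportion `1 / (a (2
* n) + 1)` of the stage, and afterwards copies `b` with zeros at the multiples of `n + 1`, so that
no unplanned run exceeds `n`. The odd terms of `a` govern only the excess of the longest run over
`n`, hence typicality. The even terms govern the density of the changes: if they diverge, the
changes have density zero and normality survives; if not, long stretches of zeros recur and spoil
the frequency of ones. Thus `encode b` pulls the pair (normal, typical) back to `evenDivergent`,
`oddDivergent`.

That pair is universal: any two `Π⁰₃` sets in a zero-dimensional Polish space reduce to it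
simultaneously (`exists_continuous_preimage_divergent`), which makes both differences hard. Not
lying in the dual class follows from hardness and a diagonal set on the Baire space
(`exists_isD2Pi0_compl_not`).

The upper bound is `Π⁰₃`-ness of limit conditions on continuous functions. It passes to `[0,1]`
because binary expansions are ambiguous only at eventually constant sequences, which are neither
normal nor typical. -/

namespace TypicalNumbers

/-! ### Finite levels of the Borel hierarchy and closure properties of `Π⁰₃`. -/

section Hierarchy

variable {X Y : Type*} [TopologicalSpace X] [TopologicalSpace Y]

theorem not_isSigma0_zero {A : Set X} : ¬ IsSigma0 0 A := by
  intro h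
  cases h with
  | iUnion_compl hβ hB hA => exact absurd (hβ 0) (Nat.not_lt_zero _)

theorem isSigma0_one_iff {A : Set X} : IsSigma0 1 A ↔ IsOpen A := by
  refine ⟨fun h => ?_, IsSigma0.of_isOpen⟩
  cases h with
  | of_isOpen hU => exact hU
  | @iUnion_compl _ _ β B hβ hB hA =>
    have h0 : β 0 = 0 := by have := hβ 0; omega
    have := hB 0
    rw [h0] at this
    exact absurd this not_isSigma0_zero

theorem isSigma0_two_iff {A : Set X} :
    IsSigma0 2 A ↔ ∃ F : ℕ → Set X, (∀ k, IsClosed (F k)) ∧ A = ⋃ k, F k := by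
  constructor
  · intro h
    cases h with
    | @iUnion_compl _ _ β B hβ hB hA =>
      refine ⟨fun k => (B k)ᶜ, fun k => ?_, hA⟩
      have hk := hB k
      have h2 := hβ k
      have h1 : β k = 1 := by
        rcases Nat.eq_zero_or_pos (β k) with h0 | h0
        · rw [h0] at hk
          exact absurd hk not_isSigma0_zero
        · omega
      rw [h1] at hk
      exact (isSigma0_one_iff.1 hk).isClosed_compl
  · rintro ⟨F, hF, rfl⟩
    refine .iUnion_compl (β := fun _ => 1) (B := fun k => (F k)ᶜ) (fun _ => by norm_num)
      (fun k => .of_isOpen (hF k).isOpen_compl) (by simp)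

theorem exists_iUnion_isClosed_of_isOpen [TopologicalSpace.MetrizableSpace X] {U : Set X}
    (hU : IsOpen U) : ∃ F : ℕ → Set X, (∀ k, IsClosed (F k)) ∧ U = ⋃ k, F k := by
  let _ := TopologicalSpace.metrizableSpaceMetric X
  obtain ⟨F, hF, -, hFU, -⟩ := hU.exists_iUnion_isClosed
  exact ⟨F, hF, hFU.symm⟩

/-- In a metrizable space the `Π⁰₃` sets are the `F_{σδ}` sets. -/
theorem isPi0_three_iff [TopologicalSpace.MetrizableSpace X] {A : Set X} :
    IsPi0 3 A ↔ ∃ F : ℕ → ℕ → Set X, (∀ i j, IsClosed (F i j)) ∧ A = ⋂ i, ⋃ j, F i j := by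
  constructor
  · intro h
    cases h with
    | @iUnion_compl _ _ β B hβ hB hA =>
      have key : ∀ i, ∃ F : ℕ → Set X, (∀ k, IsClosed (F k)) ∧ B i = ⋃ k, F k := by
        intro i
        have hi := hB i
        have h3 := hβ i
        obtain h0 | h1 | h2 : β i = 0 ∨ β i = 1 ∨ β i = 2 := by omega
        · rw [h0] at hi
          exact absurd hi not_isSigma0_zero
        · rw [h1] at hi
          exact exists_iUnion_isClosed_of_isOpen (isSigma0_one_iff.1 hi)
        · rw [h2] at hi
          exact isSigma0_two_iff.1 hi
      choose F hF hBF using key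
      refine ⟨F, hF, ?_⟩
      rw [← compl_inj_iff, hA, Set.compl_iInter]
      simp_rw [hBF]
  · rintro ⟨F, hF, rfl⟩
    refine .iUnion_compl (β := fun _ => 2) (B := fun i => ⋃ j, F i j) (fun _ => by norm_num)
      (fun i => isSigma0_two_iff.2 ⟨F i, hF i, rfl⟩) (by rw [Set.compl_iInter])

theorem IsSigma0.preimage {n : ℕ} {A : Set Y} (h : IsSigma0 n A) {f : X → Y}
    (hf : Continuous f) : IsSigma0 n (f ⁻¹' A) := by
  induction h with
  | of_isOpen hU => exact .of_isOpen (hU.preimage hf)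
  | iUnion_compl hβ hB hA ih => exact .iUnion_compl hβ ih (by simp [hA])

theorem IsPi0.preimage {n : ℕ} {A : Set Y} (h : IsPi0 n A) {f : X → Y}
    (hf : Continuous f) : IsPi0 n (f ⁻¹' A) :=
  IsSigma0.preimage (A := Aᶜ) h hf

theorem IsD2Pi0.preimage {n : ℕ} {A : Set Y} (h : IsD2Pi0 n A) {f : X → Y}
    (hf : Continuous f) : IsD2Pi0 n (f ⁻¹' A) := by
  obtain ⟨P, Q, hP, hQ, rfl⟩ := h
  exact ⟨_, _, hP.preimage hf, hQ.preimage hf, rfl⟩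

variable [TopologicalSpace.MetrizableSpace X]

theorem isPi0_three_iInter {A : ℕ → Set X} (hA : ∀ n, IsPi0 3 (A n)) :
    IsPi0 3 (⋂ n, A n) := by
  choose F hF hAF using fun n => isPi0_three_iff.1 (hA n)
  refine isPi0_three_iff.2 ⟨fun p => F p.unpair.1 p.unpair.2, fun p => hF _ _, ?_⟩
  ext x
  simp only [hAF, Set.mem_iInter, Set.mem_iUnion]
  refine ⟨fun h p => h _ _, fun h n i => ?_⟩
  simpa using h (Nat.pair n i)

theorem isPi0_three_iInter_countable {ι : Type*} [Countable ι] [Nonempty ι] {A : ι → Set X}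
    (hA : ∀ n, IsPi0 3 (A n)) : IsPi0 3 (⋂ n, A n) := by
  obtain ⟨g, hg⟩ := exists_surjective_nat ι
  rw [← hg.iInter_comp]
  exact isPi0_three_iInter fun n => hA (g n)

theorem isPi0_three_inter {A B : Set X} (hA : IsPi0 3 A) (hB : IsPi0 3 B) :
    IsPi0 3 (A ∩ B) := by
  rw [Set.inter_eq_iInter]
  exact isPi0_three_iInter_countable fun b => by cases b <;> assumption

theorem isPi0_three_of_isOpen {U : Set X} (hU : IsOpen U) : IsPi0 3 U := by
  obtain ⟨F, hF, rfl⟩ := exists_iUnion_isClosed_of_isOpen hU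
  exact isPi0_three_iff.2 ⟨fun _ => F, fun _ => hF, by rw [Set.iInter_const]⟩

theorem isPi0_three_compl_of_countable {S : Set X} (hS : S.Countable) : IsPi0 3 Sᶜ := by
  rcases S.eq_empty_or_nonempty with rfl | hne
  · rw [Set.compl_empty]
    exact isPi0_three_of_isOpen isOpen_univ
  · have : Countable S := hS
    have : Nonempty S := hne.to_subtype
    have h : Sᶜ = ⋂ s : S, {(s : X)}ᶜ := by ext x; aesop
    rw [h]
    exact isPi0_three_iInter_countable fun s => isPi0_three_of_isOpen isOpen_compl_singleton

theorem isPi0_three_setOf_tendsto {f : ℕ → X → ℝ} (hf : ∀ n, Continuous (f n)) (c : ℝ) :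
    IsPi0 3 {x | Tendsto (fun n => f n x) atTop (𝓝 c)} := by
  refine isPi0_three_iff.2
    ⟨fun k N => ⋂ n ≥ N, {x | dist (f n x) c ≤ 1 / ((k : ℝ) + 1)}, fun k N => ?_, ?_⟩
  · exact isClosed_biInter fun n _ => isClosed_le ((hf n).dist continuous_const) continuous_const
  · ext x
    simp only [Set.mem_ofPred_eq, Set.mem_iInter, Set.mem_iUnion, Metric.tendsto_atTop]
    constructor
    · intro h k
      obtain ⟨N, hN⟩ := h (1 / ((k : ℝ) + 1)) (by positivity)
      exact ⟨N, fun n hn => (hN n hn).le⟩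
    · intro h ε hε
      obtain ⟨k, hk⟩ := exists_nat_one_div_lt hε
      obtain ⟨N, hN⟩ := h k
      exact ⟨N, fun n hn => (hN n hn).trans_lt hk⟩

end Hierarchy

/-! ### Reducing pairs of `Π⁰₃` sets to divergence along even and odd indices. -/

section Reduction

variable {Z : Type*}

open Classical in
/-- The index of the closed set `⋂ i, U k i` which `z` is conjectured to lie in after inspecting
the first `j` approximations. -/
noncomputable def guess (U : ℕ → ℕ → Set Z) (z : Z) : ℕ → ℕ
  | 0 => 0
  | j + 1 => if ∃ i ≤ j, z ∉ U (guess U z j) i then guess U z j + 1 else guess U z j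

theorem guess_mono (U : ℕ → ℕ → Set Z) (z : Z) : Monotone (guess U z) := by
  refine monotone_nat_of_le_succ fun j => ?_
  rw [guess]
  split_ifs <;> omega

/-- A correct index is never refuted, so the counter cannot step past it. -/
theorem guess_le {U : ℕ → ℕ → Set Z} {z : Z} {k : ℕ} (hz : ∀ i, z ∈ U k i) (j : ℕ) :
    guess U z j ≤ k := by
  induction j with
  | zero => simp [guess]
  | succ j ih =>
    rw [guess]
    split_ifs with h
    · rcases ih.lt_or_eq with h' | h'
      · exact h'
      · rw [h'] at h
        obtain ⟨i, -, hi⟩ := h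
        exact absurd (hz i) hi
    · exact ih

/-- A guess that stays forever is tested against every approximation, hence is correct; conversely a
counter bounded by a correct index can move only finitely often. -/
theorem eventually_guess_eq_iff {U : ℕ → ℕ → Set Z} {z : Z} :
    (∃ N, ∀ j ≥ N, guess U z (j + 1) = guess U z j) ↔ ∃ k, ∀ i, z ∈ U k i := by
  constructor
  · rintro ⟨N, hN⟩
    have hc : ∀ j ≥ N, guess U z j = guess U z N := fun j hj => by
      induction j, hj using Nat.le_induction with
      | base => rfl
      | succ j hj ih => rw [hN j hj, ih]
    refine ⟨guess U z N, fun i => ?_⟩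
    by_contra hi
    have h1 := hN (max N i) (le_max_left _ _)
    rw [guess, if_pos] at h1
    · omega
    · exact ⟨i, le_max_right _ _, by rwa [hc _ (le_max_left _ _)]⟩
  · rintro ⟨k, hk⟩
    by_contra! hcon
    have grow : ∀ m, ∃ j, m ≤ guess U z j := by
      intro m
      induction m with
      | zero => exact ⟨0, Nat.zero_le _⟩
      | succ m ih =>
        obtain ⟨j, hj⟩ := ih
        obtain ⟨j', hj', hne⟩ := hcon j
        refine ⟨j' + 1, ?_⟩
        have h1 := guess_mono U z hj'
        have h2 := guess_mono U z (Nat.le_succ j')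
        simp only [Nat.succ_eq_add_one] at h2
        omega
    obtain ⟨j, hj⟩ := grow (k + 1)
    have := guess_le hk j
    omega

variable [TopologicalSpace Z]

theorem continuous_apply_discrete {W : Type*} [TopologicalSpace W] {s : Z → ℕ}
    (hs : Continuous s) {h : ℕ → Z → W} (hh : ∀ k, Continuous (h k)) :
    Continuous fun z => h (s z) z := by
  rw [continuous_iff_continuousAt]
  intro z
  have hev : ∀ᶠ y in 𝓝 z, s y = s z :=
    hs.continuousAt.eventually (p := (· = s z)) (by simp [nhds_discrete])
  refine ((hh (s z)).continuousAt (x := z)).congr ?_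
  filter_upwards [hev] with y hy
  rw [hy]

theorem continuous_ite_isClopen {W : Type*} [TopologicalSpace W] {S : Set Z}
    [DecidablePred (· ∈ S)] (hS : IsClopen S)
    {f g : Z → W} (hf : Continuous f) (hg : Continuous g) :
    Continuous fun z => if z ∈ S then f z else g z :=
  continuous_if (fun a ha => by
    rw [show {z | z ∈ S} = S from rfl, hS.frontier_eq] at ha
    exact absurd ha (Set.notMem_empty a)) hf.continuousOn
    hg.continuousOn

theorem continuous_guess {U : ℕ → ℕ → Set Z} (hU : ∀ k i, IsClopen (U k i)) (j : ℕ) :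
    Continuous fun z => guess U z j := by
  classical
  induction j with
  | zero => exact continuous_const
  | succ j ih =>
    have := continuous_apply_discrete (W := ℕ) ih
      (h := fun k (z : Z) => if z ∈ {z | ∃ i ≤ j, z ∉ U k i} then k + 1 else k) fun k => by
        refine continuous_ite_isClopen (W := ℕ) (S := {z : Z | ∃ i ≤ j, z ∉ U k i}) ?_ continuous_const continuous_const
        have : {z | ∃ i ≤ j, z ∉ U k i} = ⋃ i ∈ Set.Iic j, (U k i)ᶜ := by ext; simp
        rw [this]
        exact (Set.finite_Iic j).isClopen_biUnion fun i _ => (hU k i).compl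
    simpa only [guess, Set.mem_ofPred_eq] using this

theorem exists_isClopen_iInter [SecondCountableTopology Z]
    (hZ : TopologicalSpace.IsTopologicalBasis {s : Set Z | IsClopen s}) {F : Set Z}
    (hF : IsClosed F) : ∃ U : ℕ → Set Z, (∀ j, IsClopen (U j)) ∧ F = ⋂ j, U j := by
  obtain ⟨S, hS, hFS⟩ := hZ.open_eq_sUnion hF.isOpen_compl
  obtain ⟨T, hTc, hTS, hT⟩ := TopologicalSpace.isOpen_sUnion_countable S
    fun s hs => (hS hs : IsClopen s).isOpen
  -- Adding `∅` makes the countable family nonempty, hence the range of a sequence, without changing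
  -- its union.
  obtain ⟨V, hV⟩ := (hTc.insert ∅).exists_eq_range (Set.insert_nonempty _ _)
  refine ⟨fun j => (V j)ᶜ, fun j => ?_, ?_⟩
  · have : V j ∈ insert ∅ T := hV ▸ Set.mem_range_self j
    rcases this with h | h
    · simp only [h]
      exact isClopen_empty.compl
    · exact (hS (hTS h) : IsClopen (V j)).compl
  · rw [← Set.compl_iUnion, ← Set.sUnion_range, ← hV, Set.sUnion_insert, Set.empty_union, hT,
      ← hFS, compl_compl]

/-- Divergence to infinity is a hard `Π⁰₃` condition. -/
theorem exists_continuous_tendsto_iff [SecondCountableTopology Z]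
    [TopologicalSpace.MetrizableSpace Z]
    (hZ : TopologicalSpace.IsTopologicalBasis {s : Set Z | IsClopen s}) {P : Set Z}
    (hP : IsPi0 3 P) :
    ∃ f : Z → ℕ → ℕ, Continuous f ∧ ∀ z, Tendsto (f z) atTop atTop ↔ z ∈ P := by
  obtain ⟨F, hF, rfl⟩ := isPi0_three_iff.1 hP
  choose U hU hFU using fun n k => exists_isClopen_iInter hZ (hF n k)
  -- Row `n` has values at least `n`, and returns to `n` only when the `n`-th guess moves. So
  -- divergence over all pairs `(n, j)` fails exactly when some row's guess moves infinitely often.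
  let g : ℕ → ℕ → Z → ℕ := fun n j z =>
    if guess (U n) z (j + 1) = guess (U n) z j then n + j else n
  have hg : ∀ n j, Continuous (g n j) := fun n j =>
    (continuous_of_discreteTopology (f := fun p : ℕ × ℕ => if p.1 = p.2 then n + j else n)).comp
      ((continuous_guess (hU n) (j + 1)).prodMk (continuous_guess (hU n) j))
  refine ⟨fun z p => g p.unpair.1 p.unpair.2 z, continuous_pi fun p => hg _ _, fun z => ?_⟩
  have hz : z ∈ (⋂ i, ⋃ j, F i j) ↔
      ∀ n, ∃ N, ∀ j ≥ N, guess (U n) z (j + 1) = guess (U n) z j := by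
    simp_rw [eventually_guess_eq_iff, Set.mem_iInter, Set.mem_iUnion, hFU, Set.mem_iInter]
  rw [hz]
  constructor
  · intro h n
    obtain ⟨p, hp⟩ := eventually_atTop.1 (h.eventually_gt_atTop n)
    refine ⟨p, fun j hj => ?_⟩
    have h1 := hp (Nat.pair n j) (hj.trans (Nat.right_le_pair n j))
    by_contra hne
    simp [g, hne] at h1
  · intro h
    choose N hN using h
    rw [tendsto_atTop]
    intro M
    rw [← Nat.cofinite_eq_atTop, eventually_cofinite]
    have hfin : (⋃ n ∈ Set.Iio M, (fun j => Nat.pair n j) '' Set.Iio (max M (N n))).Finite :=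
      (Set.finite_Iio M).biUnion fun n _ => (Set.finite_Iio _).image _
    refine hfin.subset fun p hp => ?_
    obtain ⟨n, j, rfl⟩ : ∃ n j, p = Nat.pair n j := ⟨_, _, (Nat.pair_unpair p).symm⟩
    simp only [Set.mem_ofPred_eq, Nat.unpair_pair, not_le, g] at hp
    simp only [Set.mem_iUnion]
    have hn : n < M := by split_ifs at hp <;> omega
    refine ⟨n, hn, j, ?_, rfl⟩
    rw [Set.mem_Iio, lt_max_iff]
    by_contra! hcon
    rw [if_pos (hN n j hcon.2)] at hp
    omega

theorem exists_continuous_preimage_divergent [SecondCountableTopology Z]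
    [TopologicalSpace.MetrizableSpace Z]
    (hZ : TopologicalSpace.IsTopologicalBasis {s : Set Z | IsClopen s}) {P Q : Set Z}
    (hP : IsPi0 3 P) (hQ : IsPi0 3 Q) :
    ∃ f : Z → ℕ → ℕ, Continuous f ∧ f ⁻¹' evenDivergent = P ∧ f ⁻¹' oddDivergent = Q := by
  obtain ⟨f, hf, hfP⟩ := exists_continuous_tendsto_iff hZ hP
  obtain ⟨g, hg, hgQ⟩ := exists_continuous_tendsto_iff hZ hQ
  refine ⟨fun z n => if n % 2 = 0 then f z (n / 2) else g z (n / 2), continuous_pi fun n => ?_,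
    ?_, ?_⟩
  · split_ifs
    · exact (continuous_apply _).comp hf
    · exact (continuous_apply _).comp hg
  · ext z
    rw [← hfP z]
    simp [evenDivergent]
  · ext z
    rw [← hgQ z]
    simp [oddDivergent, Nat.add_mod, show ∀ n, (2 * n + 1) / 2 = n by omega]

end Reduction

/-! ### A diagonal set in `D₂(Π⁰₃)` whose complement is not in the class. -/

section Diagonal

theorem exists_enumeration_open (X : Type*) [TopologicalSpace X] [SecondCountableTopology X] :
    ∃ V : ℕ → Set X, (∀ n, IsOpen (V n)) ∧
      ∀ O : Set X, IsOpen O → ∃ g : ℕ → ℕ, O = ⋃ n, V (g n) := by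
  obtain ⟨V, hV⟩ := ((TopologicalSpace.countable_countableBasis X).insert ∅).exists_eq_range
    (Set.insert_nonempty _ _)
  have hmem : ∀ n, V n ∈ insert ∅ (TopologicalSpace.countableBasis X) :=
    fun n => hV ▸ Set.mem_range_self n
  refine ⟨V, fun n => ?_, fun O hO => ?_⟩
  · rcases hmem n with h | h
    · rw [h]
      exact isOpen_empty
    · exact TopologicalSpace.isOpen_of_mem_countableBasis h
  · obtain ⟨n₀, hn₀⟩ : ∃ n, V n = ∅ := by
      have : (∅ : Set X) ∈ Set.range V := hV ▸ Set.mem_insert _ _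
      exact this
    classical
    refine ⟨fun n => if V n ⊆ O then n else n₀, Set.Subset.antisymm (fun x hx => ?_) ?_⟩
    · obtain ⟨B, hB, hxB, hBO⟩ :=
        (TopologicalSpace.isBasis_countableBasis X).exists_subset_of_mem_open hx hO
      obtain ⟨n, rfl⟩ : B ∈ Set.range V := hV ▸ Set.mem_insert_of_mem _ hB
      exact Set.mem_iUnion.2 ⟨n, by simpa [hBO] using hxB⟩
    · refine Set.iUnion_subset fun n => ?_
      by_cases h : V n ⊆ O
      · simp [h]
      · simp [h, hn₀]

/-- On the Baire space the class `D₂(Π⁰₃)` is not closed under complements. -/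
theorem exists_isD2Pi0_compl_not :
    ∃ B : Set (ℕ → ℕ), IsD2Pi0 3 B ∧ ¬ IsD2Pi0 3 Bᶜ := by
  obtain ⟨V, hVo, hV⟩ := exists_enumeration_open (ℕ → ℕ)
  -- The point `x ∘ e` is read as a code of a `Π⁰₃` set, and `S e` asks whether `x` lies in the set
  -- that it codes.
  let S : (ℕ → ℕ) → Set (ℕ → ℕ) := fun e =>
    {x | ∀ i, ∃ j, ∀ k, x ∉ V (x (e (Nat.pair i (Nat.pair j k))))}
  have hS : ∀ e, IsPi0 3 (S e) := fun e => by
    refine isPi0_three_iff.2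
      ⟨fun i j => ⋂ k, {x | x ∈ V (x (e (Nat.pair i (Nat.pair j k))))}ᶜ, fun i j => ?_, ?_⟩
    · refine isClosed_iInter fun k => IsOpen.isClosed_compl ?_
      have : {x : ℕ → ℕ | x ∈ V (x (e (Nat.pair i (Nat.pair j k))))} =
          ⋃ c, {x | x (e (Nat.pair i (Nat.pair j k))) = c} ∩ V c := by ext; simp
      rw [this]
      exact isOpen_iUnion fun c =>
        ((isOpen_discrete {c}).preimage (continuous_apply (A := fun _ => ℕ) _)).inter (hVo c)
    · ext x
      simp [S]
  have huniv : ∀ P : Set (ℕ → ℕ), IsPi0 3 P → ∃ a : ℕ → ℕ,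
      ∀ x, x ∈ P ↔ ∀ i, ∃ j, ∀ k, x ∉ V (a (Nat.pair i (Nat.pair j k))) := fun P hP => by
    obtain ⟨F, hF, rfl⟩ := isPi0_three_iff.1 hP
    choose g hg using fun i j => hV (F i j)ᶜ (hF i j).isOpen_compl
    refine ⟨fun p => g p.unpair.1 p.unpair.2.unpair.1 p.unpair.2.unpair.2, fun x => ?_⟩
    have : ∀ i j, x ∈ F i j ↔ ∀ k, x ∉ V (g i j k) := fun i j => by
      rw [← not_iff_not, ← Set.mem_compl_iff, hg i j]
      simp
    simp [this]
  refine ⟨S (fun p => 2 * p) \ S (fun p => 2 * p + 1),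
    ⟨S (fun p => 2 * p), S (fun p => 2 * p + 1), hS (fun p => 2 * p),
      hS (fun p => 2 * p + 1), rfl⟩, ?_⟩
  rintro ⟨P, Q, hP, hQ, hPQ⟩
  obtain ⟨a, ha⟩ := huniv P hP
  obtain ⟨b, hb⟩ := huniv Q hQ
  -- Interleaving codes of `P` and `Q` gives a point that lies in the diagonal set if and only if it
  -- lies in `P \ Q`, the supposed complement.
  let x : ℕ → ℕ := fun n => if n % 2 = 0 then a (n / 2) else b (n / 2)
  have hxa : ∀ p, x (2 * p) = a p := fun p => by simp [x]
  have hxb : ∀ p, x (2 * p + 1) = b p := fun p => by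
    simp [x, Nat.add_mod, show ∀ n, (2 * n + 1) / 2 = n by omega]
  have h1 : x ∈ S (fun p => 2 * p) ↔ x ∈ P := by simp only [S, Set.mem_ofPred_eq, hxa, ha]
  have h2 : x ∈ S (fun p => 2 * p + 1) ↔ x ∈ Q := by simp only [S, Set.mem_ofPred_eq, hxb, hb]
  have h3 := Set.ext_iff.1 hPQ x
  rw [Set.mem_compl_iff, Set.mem_sdiff, Set.mem_sdiff, h1, h2] at h3
  tauto

theorem isTopologicalBasis_isClopen_baire :
    TopologicalSpace.IsTopologicalBasis {s : Set (ℕ → ℕ) | IsClopen s} := by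
  refine TopologicalSpace.isTopologicalBasis_of_isOpen_of_nhds (fun s hs => hs.isOpen) ?_
  intro x O hx hO
  obtain ⟨-, ⟨U, F, -, rfl⟩, hxB, hBO⟩ :=
    (isTopologicalBasis_pi fun _ : ℕ =>
      TopologicalSpace.isTopologicalBasis_opens (α := ℕ)).exists_subset_of_mem_open hx hO
  refine ⟨_, ⟨isClosed_set_pi fun i _ => isClosed_discrete _, ?_⟩, hxB, hBO⟩
  exact isOpen_set_pi F.finite_toSet fun i _ => isOpen_discrete _

/-- Membership and hardness imply completeness. -/
theorem IsD2Pi0Complete.of_hard {X : Type*} [TopologicalSpace X] {A : Set X}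
    (hA : IsD2Pi0 3 A)
    (hard : ∀ (Z : Type) [TopologicalSpace Z] [PolishSpace Z],
      TopologicalSpace.IsTopologicalBasis {s : Set Z | IsClopen s} →
      ∀ B : Set Z, IsD2Pi0 3 B → ∃ f : Z → X, Continuous f ∧ f ⁻¹' A = B) :
    IsD2Pi0Complete 3 A := by
  refine ⟨hA, fun hc => ?_, hard⟩
  obtain ⟨B, hB, hBc⟩ := exists_isD2Pi0_compl_not
  obtain ⟨f, hf, rfl⟩ := hard (ℕ → ℕ) isTopologicalBasis_isClopen_baire B hB
  exact hBc (hc.preimage hf)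

end Diagonal

/-! ### Run lengths, block counts and the growth of the logarithm. -/

section Counting

variable {x : ℕ → Fin 2} {n : ℕ}

theorem bddAbove_runs (n : ℕ) (x : ℕ → Fin 2) :
    BddAbove {j : ℕ | ∃ i : ℕ, i + j ≤ n ∧ ∀ k < j, x (i + k) = 1} :=
  ⟨n, by rintro j ⟨i, hij, -⟩; omega⟩

theorem le_runLength {i j : ℕ} (hij : i + j ≤ n) (h : ∀ k < j, x (i + k) = 1) :
    j ≤ runLength n x :=
  le_csSup (bddAbove_runs n x) ⟨i, hij, h⟩

theorem runLength_le {B : ℕ} (h : ∀ i j, i + j ≤ n → (∀ k < j, x (i + k) = 1) → j ≤ B) :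
    runLength n x ≤ B := by
  refine csSup_le ⟨0, 0, by simp⟩ ?_
  rintro j ⟨i, hij, hj⟩
  exact h i j hij hj

theorem blockCount_const_one (x : ℕ → Fin 2) (d : Fin 2) (n : ℕ) :
    blockCount x (fun _ : Fin 1 => d) n = ((Finset.range n).filter fun i => x i = d).card := by
  unfold blockCount
  congr 1
  ext i
  simp
  omega

theorem tendsto_logb_natCast_atTop :
    Tendsto (fun n : ℕ => Real.logb 2 (n : ℝ)) atTop atTop :=
  (Real.tendsto_logb_atTop one_lt_two).comp tendsto_natCast_atTop_atTop

theorem tendsto_logb_div_natCast :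
    Tendsto (fun n : ℕ => Real.logb 2 (n : ℝ) / (n : ℝ)) atTop (𝓝 0) := by
  have h := (Real.isLittleO_log_id_atTop.tendsto_div_nhds_zero.comp
    tendsto_natCast_atTop_atTop).div_const (Real.log 2)
  rw [zero_div] at h
  refine h.congr fun n => ?_
  simp [Real.logb, div_right_comm]

end Counting

/-! ### Eventually constant sequences and ambiguity of binary expansions. -/

section EventuallyConstant

/-- The binary sequences that are constant from some index on. -/
def eventuallyConst : Set (ℕ → Fin 2) := {x | ∃ N d, ∀ n ≥ N, x n = d}

theorem countable_eventuallyConst : eventuallyConst.Countable := by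
  have h : eventuallyConst ⊆ ⋃ N : ℕ, Set.range
      fun p : (Fin N → Fin 2) × Fin 2 => fun i => if h : i < N then p.1 ⟨i, h⟩ else p.2 := by
    rintro x ⟨N, d, hx⟩
    refine Set.mem_iUnion.2 ⟨N, (fun i => x i, d), ?_⟩
    ext1 i
    by_cases hi : i < N
    · simp [hi]
    · simp [hi, hx i (not_lt.1 hi)]
  exact (Set.countable_iUnion fun N => Set.countable_range _).mono h

theorem notMem_normalSeq_of_eventuallyConst {x : ℕ → Fin 2} (hx : x ∈ eventuallyConst) :
    x ∉ normalSeq := by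
  obtain ⟨N, d, hd⟩ := hx
  intro h
  -- In `Fin 2`, `d + 1` is the other digit; it occurs at most `N` times, so its frequency cannot be
  -- `1 / 2`.
  have h1 := h 1 fun _ => d + 1
  simp only [blockCount_const_one] at h1
  have h2 : Tendsto (fun n : ℕ => (N : ℝ) / n) atTop (𝓝 0) :=
    tendsto_const_nhds.div_atTop tendsto_natCast_atTop_atTop
  have h3 := le_of_tendsto_of_tendsto' h1 h2 fun n => by
    gcongr
    calc _ ≤ (Finset.range N).card := Finset.card_le_card fun i hi => by
            rw [Finset.mem_filter] at hi
            rw [Finset.mem_range]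
            by_contra! hcon
            rw [hd i hcon] at hi
            have := hi.2
            omega
      _ = N := Finset.card_range N
  norm_num at h3

/-- A tail of ones makes the longest run grow linearly, a tail of zeros keeps it bounded; neither is
logarithmic. -/
theorem notMem_typicalSeq_of_eventuallyConst {x : ℕ → Fin 2} (hx : x ∈ eventuallyConst) :
    x ∉ typicalSeq := by
  obtain ⟨N, d, hd⟩ := hx
  intro h
  have h : Tendsto (fun n : ℕ => (runLength n x : ℝ) / Real.logb 2 (n : ℝ)) atTop (𝓝 1) := h
  rcases eq_or_ne d 1 with rfl | hd1
  · have h1 := h.mul tendsto_logb_div_natCast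
    rw [mul_zero] at h1
    have h2 : Tendsto (fun n : ℕ => 1 - (N : ℝ) / n) atTop (𝓝 (1 - 0)) :=
      tendsto_const_nhds.sub (tendsto_const_nhds.div_atTop tendsto_natCast_atTop_atTop)
    have h3 := le_of_tendsto_of_tendsto h2 h1 ?_
    · norm_num at h3
    filter_upwards [tendsto_logb_natCast_atTop.eventually_gt_atTop 0,
      eventually_ge_atTop (N + 1)] with n hn hnN
    have hpos : (0 : ℝ) < n := by exact_mod_cast (by omega : 0 < n)
    have hr : n - N ≤ runLength n x :=
      le_runLength (i := N) (by omega) fun k _ => hd _ (by omega)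
    have hr' : (n : ℝ) ≤ runLength n x + N := by exact_mod_cast (by omega)
    rw [div_mul_div_cancel₀ hn.ne', one_sub_div hpos.ne']
    gcongr
    linarith
  · have h2 : Tendsto (fun n : ℕ => (N : ℝ) / Real.logb 2 (n : ℝ)) atTop (𝓝 0) :=
      tendsto_const_nhds.div_atTop tendsto_logb_natCast_atTop
    have h3 := le_of_tendsto_of_tendsto h h2 ?_
    · norm_num at h3
    filter_upwards [tendsto_logb_natCast_atTop.eventually_gt_atTop 0] with n hn
    gcongr
    refine runLength_le fun i j hij hj => ?_
    by_contra! hcon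
    have := hj N hcon
    rw [hd _ (by omega)] at this
    exact hd1 this

/-- Cancelling the common prefix and rescaling, the tail of `x` has value `1` plus that of the tail
of `y`. Both values lie in `[0,1]`, so they are the extremes `1` and `0`, each attained by a single
sequence. -/
theorem tail_of_ofDigits_eq {x y : ℕ → Fin 2} {k : ℕ} (hlt : ∀ i < k, x i = y i)
    (hx : x k = 0) (hy : y k = 1) (h : Real.ofDigits x = Real.ofDigits y) :
    (∀ n ≥ k + 1, x n = 1) ∧ ∀ n ≥ k + 1, y n = 0 := by
  rw [Real.ofDigits_eq_sum_add_ofDigits x (k + 1), Real.ofDigits_eq_sum_add_ofDigits y (k + 1),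
    Finset.sum_range_succ, Finset.sum_range_succ,
    Finset.sum_congr rfl fun i hi => show Real.ofDigitsTerm x i = Real.ofDigitsTerm y i by
      simp [Real.ofDigitsTerm, hlt i (Finset.mem_range.1 hi)]] at h
  have hxk : Real.ofDigitsTerm x k = 0 := by simp [Real.ofDigitsTerm, hx]
  have hyk : Real.ofDigitsTerm y k = ((2 : ℝ) ^ (k + 1))⁻¹ := by simp [Real.ofDigitsTerm, hy]
  rw [hxk, hyk, Nat.cast_ofNat] at h
  have hp : (0 : ℝ) < ((2 : ℝ) ^ (k + 1))⁻¹ := by positivity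
  have h' : Real.ofDigits (fun i => x (i + (k + 1))) =
      1 + Real.ofDigits fun i => y (i + (k + 1)) := by
    apply mul_left_cancel₀ hp.ne'
    linear_combination h
  have hx1 := Real.ofDigits_le_one fun i => x (i + (k + 1))
  have hy0 := Real.ofDigits_nonneg fun i => y (i + (k + 1))
  constructor
  · intro n hn
    by_contra hne
    have hlt : Real.ofDigits (fun i => x (i + (k + 1))) < Real.ofDigits fun _ => Fin.last 1 := by
      refine Summable.tsum_lt_tsum (i := n - (k + 1)) (fun i => ?_) ?_
        Real.summable_ofDigitsTerm Real.summable_ofDigitsTerm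
      · simp only [Real.ofDigitsTerm]
        gcongr
        exact Fin.le_last _
      · simp only [Real.ofDigitsTerm]
        gcongr
        rw [Nat.sub_add_cancel hn]
        show x n < 1
        omega
    rw [Real.ofDigits_const_last_eq_one] at hlt
    linarith
  · intro n hn
    have hz : Real.ofDigits (fun i => y (i + (k + 1))) = 0 := by linarith
    have hsum : HasSum (Real.ofDigitsTerm fun i => y (i + (k + 1))) 0 :=
      hz ▸ Real.summable_ofDigitsTerm.hasSum
    have := (hasSum_zero_iff_of_nonneg fun i => Real.ofDigitsTerm_nonneg).1 hsum
    have := congrFun this (n - (k + 1))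
    simp only [Real.ofDigitsTerm, Nat.sub_add_cancel hn, Pi.zero_apply, mul_eq_zero,
      Nat.cast_eq_zero] at this
    rcases this with h0 | h0
    · exact Fin.ext h0
    · exact absurd h0 (by positivity)

theorem eq_or_eventuallyConst_of_ofDigits_eq {x y : ℕ → Fin 2}
    (h : Real.ofDigits x = Real.ofDigits y) :
    x = y ∨ x ∈ eventuallyConst ∧ y ∈ eventuallyConst := by
  classical
  by_cases hxy : x = y
  · exact .inl hxy
  right
  have hex : ∃ k, x k ≠ y k := Function.ne_iff.1 hxy
  have hk := Nat.find_spec hex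
  have hlt : ∀ i < Nat.find hex, x i = y i := fun i hi => not_not.1 (Nat.find_min hex hi)
  rcases eq_or_ne (x (Nat.find hex)) 0 with h0 | h0
  · obtain ⟨h1, h2⟩ := tail_of_ofDigits_eq hlt h0 (by omega) h
    exact ⟨⟨_, _, h1⟩, _, _, h2⟩
  · obtain ⟨h1, h2⟩ := tail_of_ofDigits_eq (fun i hi => (hlt i hi).symm) (by omega) (by omega)
      h.symm
    exact ⟨⟨_, _, h2⟩, _, _, h1⟩

end EventuallyConstant

/-! ### Upper bounds on complexity, for sequences and for numbers. -/

section Complexity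

theorem continuous_of_forall_lt {Y : Type*} [TopologicalSpace Y] (n : ℕ)
    {f : (ℕ → Fin 2) → Y} (hf : ∀ x y, (∀ i < n, x i = y i) → f x = f y) : Continuous f := by
  have h : f = (fun u : Fin n → Fin 2 => f fun i => if h : i < n then u ⟨i, h⟩ else 0) ∘
      fun x i => x i := by
    ext1 x
    exact hf _ _ fun i hi => by simp [hi]
  rw [h]
  exact continuous_of_discreteTopology.comp (by fun_prop)

theorem isPi0_typicalSeq : IsPi0 3 typicalSeq := by
  refine isPi0_three_setOf_tendsto (fun n => continuous_of_forall_lt n fun x y hxy => ?_) 1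
  have : runLength n x = runLength n y := by
    unfold runLength
    congr 1
    ext j
    refine exists_congr fun i => and_congr_right fun hij => forall₂_congr fun k hk => ?_
    rw [hxy _ (by omega)]
  rw [this]

theorem isPi0_normalSeq : IsPi0 3 normalSeq := by
  have h : normalSeq = ⋂ p : Σ m : ℕ, (Fin m → Fin 2),
      {x | Tendsto (fun n : ℕ => (blockCount x p.2 n : ℝ) / (n : ℝ)) atTop (𝓝 (1 / 2 ^ p.1))} := by
    ext x
    simp [normalSeq, Sigma.forall]
  rw [h]
  refine isPi0_three_iInter_countable fun p => isPi0_three_setOf_tendsto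
    (fun n => continuous_of_forall_lt n fun x y hxy => ?_) _
  have : blockCount x p.2 n = blockCount y p.2 n := by
    unfold blockCount
    congr 1
    refine Finset.filter_congr fun i _ => and_congr_right fun hi => forall_congr' fun k => ?_
    rw [hxy _ (by omega)]
  rw [this]

/-- The number in the unit interval with a given binary expansion. -/
noncomputable def toUnit (x : ℕ → Fin 2) : unitInterval :=
  ⟨Real.ofDigits x, Real.ofDigits_nonneg x, Real.ofDigits_le_one x⟩

theorem continuous_toUnit : Continuous toUnit :=
  Real.continuous_ofDigits.subtype_mk _

theorem toUnit_preimage_image {T : Set (ℕ → Fin 2)} (hT : Disjoint T eventuallyConst) :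
    toUnit ⁻¹' (toUnit '' T) = T := by
  refine Set.Subset.antisymm ?_ (Set.subset_preimage_image _ _)
  rintro x ⟨y, hy, hyx⟩
  rcases eq_or_eventuallyConst_of_ofDigits_eq (Subtype.ext_iff.1 hyx) with rfl | h
  · exact hy
  · exact absurd h.1 (Set.disjoint_left.1 hT hy)

theorem toUnit_surjective : Function.Surjective toUnit := by
  rintro ⟨y, hy⟩
  obtain ⟨x, -, rfl⟩ := Real.ofDigits_SurjOn one_lt_two hy
  exact ⟨x, rfl⟩

/-- Compactness makes images of closed sets closed. Images commute with the intersection away from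
the ambiguous points, and these form a countable set, whose removal stays within `Π⁰₃`. -/
theorem isPi0_toUnit_image {T : Set (ℕ → Fin 2)} (hT : Disjoint T eventuallyConst)
    (h : IsPi0 3 T) : IsPi0 3 (toUnit '' T) := by
  obtain ⟨F, hF, hTF⟩ := isPi0_three_iff.1 h
  have key : toUnit '' T =
      (⋂ i, ⋃ j, toUnit '' F i j) ∩ (toUnit '' eventuallyConst)ᶜ := by
    ext y
    constructor
    · rintro ⟨x, hx, rfl⟩
      refine ⟨?_, ?_⟩
      · rw [hTF] at hx
        simp only [Set.mem_iInter, Set.mem_iUnion] at hx ⊢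
        exact fun i => (hx i).imp fun j hj => ⟨x, hj, rfl⟩
      · rintro ⟨z, hz, hzx⟩
        rcases eq_or_eventuallyConst_of_ofDigits_eq (Subtype.ext_iff.1 hzx) with rfl | h
        · exact Set.disjoint_left.1 hT hx hz
        · exact Set.disjoint_left.1 hT hx h.2
    · rintro ⟨h1, h2⟩
      obtain ⟨x, rfl⟩ := toUnit_surjective y
      refine ⟨x, ?_, rfl⟩
      rw [hTF]
      simp only [Set.mem_iInter, Set.mem_iUnion] at h1 ⊢
      refine fun i => (h1 i).imp fun j hj => ?_
      obtain ⟨z, hz, hzx⟩ := hj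
      rcases eq_or_eventuallyConst_of_ofDigits_eq (Subtype.ext_iff.1 hzx) with rfl | h
      · exact hz
      · exact absurd ⟨x, h.2, rfl⟩ h2
  rw [key]
  refine isPi0_three_inter (isPi0_three_iff.2 ⟨_, fun i j => ?_, rfl⟩)
    (isPi0_three_compl_of_countable (countable_eventuallyConst.image _))
  exact ((hF i j).isCompact.image continuous_toUnit).isClosed

theorem disjoint_typicalSeq : Disjoint typicalSeq eventuallyConst :=
  Set.disjoint_left.2 fun _ h h' => notMem_typicalSeq_of_eventuallyConst h' h

theorem disjoint_normalSeq : Disjoint normalSeq eventuallyConst :=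
  Set.disjoint_left.2 fun _ h h' => notMem_normalSeq_of_eventuallyConst h' h

theorem tpcN_eq_image : TpcN = toUnit '' typicalSeq := by
  ext y
  simp only [TpcN, toUnit, Set.mem_ofPred_eq, Set.mem_image, Subtype.ext_iff, and_comm]

theorem normal_eq_image : Normal = toUnit '' normalSeq := by
  ext y
  simp only [Normal, toUnit, Set.mem_ofPred_eq, Set.mem_image, Subtype.ext_iff, and_comm]

end Complexity

/-! ### Existence of a normal sequence by the strong law of large numbers. -/

section NormalExists

open MeasureTheory ProbabilityTheory

/-- The indicator of an occurrence of the block `w` at position `i`. -/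
noncomputable def occ {m : ℕ} (w : Fin m → Fin 2) (i : ℕ) (x : ℕ → Fin 2) : ℝ :=
  if (fun k : Fin m => x (i + k)) = w then 1 else 0

/-- Positions are split by residue modulo `m` because windows of length `m` starting in one residue
class are disjoint, hence independent. -/
theorem sum_range_mul_eq {m : ℕ} (f : ℕ → ℝ) (N : ℕ) :
    ∑ i ∈ Finset.range (m * N), f i =
      ∑ r ∈ Finset.range m, ∑ j ∈ Finset.range N, f (r + j * m) := by
  induction N with
  | zero => simp
  | succ N ih =>
    simp only [Finset.sum_range_succ, Finset.sum_add_distrib, ← ih, Nat.mul_succ,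
      Finset.sum_range_add]
    congr 1
    refine Finset.sum_congr rfl fun r _ => ?_
    congr 1
    ring

theorem abs_blockCount_sub_le {m : ℕ} (hm : 0 < m) (w : Fin m → Fin 2) (x : ℕ → Fin 2) (n : ℕ) :
    |(blockCount x w n : ℝ) - ∑ i ∈ Finset.range (m * (n / m)), occ w i x| ≤ m := by
  have hn := Nat.div_add_mod n m
  have hr := Nat.mod_lt n hm
  set N := n / m
  have hsum : ∑ i ∈ Finset.range (m * N), occ w i x =
      (((Finset.range (m * N)).filter fun i => (fun k : Fin m => x (i + k)) = w).card : ℝ) := by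
    simp [occ]
  have h1 : blockCount x w n ≤
      ((Finset.range (m * N)).filter fun i => (fun k : Fin m => x (i + k)) = w).card := by
    refine Finset.card_le_card fun i hi => ?_
    simp only [Finset.mem_filter, Finset.mem_range, funext_iff] at hi ⊢
    exact ⟨by omega, hi.2.2⟩
  have h2 : ((Finset.range (m * N)).filter fun i => (fun k : Fin m => x (i + k)) = w).card ≤
      blockCount x w n + m := by
    calc _ ≤ (((Finset.range (n + 1)).filter
              (fun i => i + m ≤ n ∧ ∀ k : Fin m, x (i + k) = w k)) ∪
            Finset.Ico (n + 1 - m) (n + 1)).card := Finset.card_le_card fun i hi => by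
              simp only [Finset.mem_filter, Finset.mem_range, funext_iff, Finset.mem_union,
                Finset.mem_Ico] at hi ⊢
              by_cases him : i + m ≤ n
              · exact .inl ⟨by omega, him, hi.2⟩
              · right
                omega
      _ ≤ _ := by
        refine (Finset.card_union_le _ _).trans ?_
        rw [Nat.card_Ico]
        exact Nat.add_le_add_left (by omega) _
  rw [hsum, abs_le]
  have h1' : (blockCount x w n : ℝ) ≤
    ((Finset.range (m * N)).filter fun i => (fun k : Fin m => x (i + k)) = w).card :=
      by exact_mod_cast h1
  have h2' : (((Finset.range (m * N)).filter fun i =>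
    (fun k : Fin m => x (i + k)) = w).card : ℝ) ≤ blockCount x w n + m := by exact_mod_cast h2
  have := Nat.cast_nonneg (α := ℝ) m
  constructor <;> linarith

theorem tendsto_div_of_subsampled {f g : ℕ → ℝ} {m : ℕ} (hm : 0 < m) {c K : ℝ}
    (hfg : ∀ n, |f n - g (n / m)| ≤ K)
    (hg : Tendsto (fun N : ℕ => g N / N) atTop (𝓝 (m * c))) :
    Tendsto (fun n : ℕ => f n / n) atTop (𝓝 c) := by
  rw [tendsto_iff_dist_tendsto_zero]
  have h1 : Tendsto (fun n : ℕ => dist (g (n / m) / (n / m : ℕ)) (m * c) + (K + m * |c|) / n)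
      atTop (𝓝 (0 + 0)) :=
    ((tendsto_iff_dist_tendsto_zero.1 hg).comp (Nat.tendsto_div_const_atTop hm.ne')).add
      (tendsto_const_nhds.div_atTop tendsto_natCast_atTop_atTop)
  rw [add_zero] at h1
  refine squeeze_zero' (Eventually.of_forall fun _ => dist_nonneg) ?_ h1
  filter_upwards [eventually_ge_atTop m] with n hn
  have hN : 0 < n / m := Nat.div_pos hn hm
  have hdm := Nat.div_add_mod n m
  have hr := Nat.mod_lt n hm
  have hle : n / m ≤ n := Nat.div_le_self n m
  have hKn := hfg n
  generalize n / m = N at *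
  have hnpos : (0 : ℝ) < n := by exact_mod_cast (by omega : 0 < n)
  have hNpos : (0 : ℝ) < N := by exact_mod_cast hN
  have hleR : (N : ℝ) ≤ n := by exact_mod_cast hle
  have hup : (m : ℝ) * N ≤ n := by exact_mod_cast (by omega : m * N ≤ n)
  have hlo : (n : ℝ) ≤ m * N + m := by exact_mod_cast (by omega : n ≤ m * N + m)
  rw [Real.dist_eq, Real.dist_eq]
  -- Three errors: subsampling, at most `K`; convergence of `g`; and rounding `n` down to `m * N`,
  -- which costs at most `m * |c|`.
  have e1 : f n / n - c = ((f n - g N) + (g N - m * c * N) + c * (m * N - n)) / n := by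
    field_simp
    ring
  have e2 : g N / N - m * c = (g N - m * c * N) / N := by field_simp
  rw [e1, e2, abs_div, abs_div, abs_of_pos hnpos, abs_of_pos hNpos]
  have hc : |c * (m * N - n)| ≤ m * |c| := by
    rw [abs_mul, mul_comm]
    exact mul_le_mul_of_nonneg_right (abs_le.2 ⟨by linarith, by linarith [hNpos]⟩) (abs_nonneg c)
  calc _ ≤ (|g N - m * c * N| + (K + m * |c|)) / n := by
        gcongr
        calc _ ≤ |f n - g N| + |g N - m * c * N| + |c * (m * N - n)| := abs_add_three _ _ _
          _ ≤ _ := by linarith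
    _ = |g N - m * c * N| / n + (K + m * |c|) / n := add_div _ _ _
    _ ≤ _ := by gcongr

theorem mem_normalSeq_of_residues {x : ℕ → Fin 2}
    (h : ∀ (m : ℕ) (w : Fin m → Fin 2) (r : ℕ), 0 < m → Tendsto
      (fun N : ℕ => (∑ j ∈ Finset.range N, occ w (r + j * m) x) / N) atTop (𝓝 ((1 / 2) ^ m))) :
    x ∈ normalSeq := by
  intro m w
  rcases Nat.eq_zero_or_pos m with rfl | hm
  -- The empty block occurs at all positions `0, …, n`, one more than the number of digits.
  · have hb : ∀ n, blockCount x w n = n + 1 := fun n => by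
      unfold blockCount
      rw [Finset.filter_true_of_mem, Finset.card_range]
      intro i hi
      rw [Finset.mem_range] at hi
      exact ⟨by omega, fun k => k.elim0⟩
    simp only [hb, pow_zero, div_one, Nat.cast_add, Nat.cast_one]
    have h1 : Tendsto (fun n : ℕ => 1 + (1 : ℝ) / n) atTop (𝓝 (1 + 0)) :=
      tendsto_const_nhds.add (tendsto_const_nhds.div_atTop tendsto_natCast_atTop_atTop)
    rw [add_zero] at h1
    refine h1.congr' ?_
    filter_upwards [eventually_gt_atTop 0] with n hn
    have : (n : ℝ) ≠ 0 := by exact_mod_cast hn.ne'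
    field_simp
  · refine tendsto_div_of_subsampled hm
      (g := fun N => ∑ i ∈ Finset.range (m * N), occ w i x) (abs_blockCount_sub_le hm w x) ?_
    have h1 := tendsto_finsetSum (Finset.range m) fun r _ => h m w r hm
    rw [Finset.sum_const, Finset.card_range, nsmul_eq_mul, one_div_pow] at h1
    refine h1.congr fun N => ?_
    rw [sum_range_mul_eq, Finset.sum_div]

/-- The law of a fair coin. -/
noncomputable def coin : Measure (Fin 2) := (PMF.uniformOfFintype (Fin 2)).toMeasure

instance : IsProbabilityMeasure coin := by
  unfold coin
  infer_instance

theorem coin_singleton (d : Fin 2) : coin {d} = 2⁻¹ := by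
  simp [coin]

/-- The law of a sequence of independent fair coin tosses. -/
noncomputable def coins : Measure (ℕ → Fin 2) := Measure.infinitePi fun _ => coin

instance : IsProbabilityMeasure coins := by
  unfold coins
  infer_instance

theorem iIndepFun_coins : iIndepFun (fun (i : ℕ) (x : ℕ → Fin 2) => x i) coins :=
  iIndepFun_infinitePi (X := fun _ (d : Fin 2) => d) fun _ => measurable_id

theorem map_window_coins (m s : ℕ) :
    coins.map (fun x (k : Fin m) => x (s + k)) = Measure.pi fun _ => coin := by
  have h := (iIndepFun_coins.precomp (g := fun k : Fin m => s + (k : ℕ))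
    fun a b hab => by ext; simpa using hab).map_fun_eq_pi_map
      (fun k => (measurable_pi_apply _).aemeasurable)
  simpa only [coins, Measure.infinitePi_map_eval] using h

theorem measurable_window (m s : ℕ) :
    Measurable fun (x : ℕ → Fin 2) (k : Fin m) => x (s + k) := by fun_prop

theorem measurable_occ {m : ℕ} (w : Fin m → Fin 2) (i : ℕ) : Measurable (occ w i) :=
  (Measurable.of_discrete (f := fun u : Fin m → Fin 2 => if u = w then (1 : ℝ) else 0)).comp
    (measurable_window m i)

theorem identDistrib_occ {m : ℕ} (w : Fin m → Fin 2) (i j : ℕ) :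
    IdentDistrib (occ w i) (occ w j) coins coins :=
  IdentDistrib.comp (u := fun u : Fin m → Fin 2 => if u = w then (1 : ℝ) else 0)
    ⟨(measurable_window m i).aemeasurable, (measurable_window m j).aemeasurable, by
      rw [map_window_coins, map_window_coins]⟩ Measurable.of_discrete

theorem integral_occ {m : ℕ} (w : Fin m → Fin 2) (i : ℕ) :
    ∫ x, occ w i x ∂coins = (1 / 2) ^ m := by
  have h1 : occ w i =
      ((fun (x : ℕ → Fin 2) (k : Fin m) => x (i + k)) ⁻¹' {w}).indicator 1 := by
    ext x
    by_cases hx : (fun k : Fin m => x (i + k)) = w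
    · rw [Set.indicator_of_mem (show x ∈ _ from hx)]
      simp [occ, hx]
    · rw [Set.indicator_of_notMem (show x ∉ _ from hx)]
      simp [occ, hx]
  rw [h1, integral_indicator_one (measurable_window m i (measurableSet_singleton w)),
    measureReal_def, ← Measure.map_apply (measurable_window m i) (measurableSet_singleton w),
    map_window_coins, Measure.pi_singleton]
  simp [coin_singleton]

theorem integrable_occ {m : ℕ} (w : Fin m → Fin 2) (i : ℕ) : Integrable (occ w i) coins := by
  refine Integrable.of_bound (measurable_occ w i).aestronglyMeasurable 1 (.of_forall fun x => ?_)
  unfold occ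
  split_ifs <;> simp

theorem indepFun_occ {m : ℕ} (w : Fin m → Fin 2) {s t : ℕ} (hst : s + m ≤ t) :
    IndepFun (occ w s) (occ w t) coins := by
  have h := iIndepFun_coins.indepFun_finset (Finset.Ico s (s + m)) (Finset.Ico t (t + m))
    (Finset.disjoint_left.2 fun a ha hb => by
      rw [Finset.mem_Ico] at ha hb
      omega) fun i => measurable_pi_apply i
  let g : ∀ s : ℕ, (Finset.Ico s (s + m) → Fin 2) → ℝ := fun s u =>
    if (fun k : Fin m => u ⟨s + k, by simp⟩) = w then 1 else 0
  exact h.comp (φ := g s) (ψ := g t) Measurable.of_discrete Measurable.of_discrete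

/-- The strong law applies to each triple of length, block and residue; there are countably many, so
almost every sequence satisfies all the limits at once. -/
theorem nonempty_normalSeq : normalSeq.Nonempty := by
  have key : ∀ᵐ x ∂coins, ∀ p : (Σ m : ℕ, (Fin m → Fin 2)) × ℕ, 0 < p.1.1 → Tendsto
      (fun N : ℕ => (∑ j ∈ Finset.range N, occ p.1.2 (p.2 + j * p.1.1) x) / N) atTop
      (𝓝 ((1 / 2) ^ p.1.1)) := by
    rw [ae_all_iff]
    rintro ⟨⟨m, w⟩, r⟩
    rcases Nat.eq_zero_or_pos m with rfl | hm
    · simp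
    have h := strong_law_ae_real (μ := coins) (fun j => occ w (r + j * m)) (integrable_occ _ _)
      (fun i j hij => ?_) fun i => identDistrib_occ _ _ _
    · filter_upwards [h] with x hx _
      rwa [integral_occ] at hx
    · have aux : ∀ i j, i < j → r + i * m + m ≤ r + j * m := fun i j hij => by
        have := Nat.mul_le_mul_right m hij
        rw [Nat.succ_eq_add_one, add_mul] at this
        omega
      rcases hij.lt_or_gt with hij | hij
      · exact indepFun_occ w (aux _ _ hij)
      · exact (indepFun_occ w (aux _ _ hij)).symm
  obtain ⟨x, hx⟩ := key.exists
  exact ⟨x, mem_normalSeq_of_residues fun m w r hm => hx (⟨m, w⟩, r) hm⟩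

end NormalExists

/-! ### Normality is stable under changes of density zero. -/

section Perturbation

/-- The number of indices below `n` at which `x` and `y` differ. -/
def diffCount (x y : ℕ → Fin 2) (n : ℕ) : ℕ :=
  ((Finset.range n).filter fun i => x i ≠ y i).card

theorem diffCount_comm (x y : ℕ → Fin 2) (n : ℕ) : diffCount x y n = diffCount y x n := by
  simp only [diffCount, ne_comm]

theorem diffCount_mono (x y : ℕ → Fin 2) : Monotone (diffCount x y) := fun _ _ h =>
  Finset.card_le_card (Finset.filter_subset_filter _ (Finset.range_mono h))

/-- A changed digit affects at most the `m` windows that contain it. -/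
theorem blockCount_le_add_diffCount {m : ℕ} (x y : ℕ → Fin 2) (w : Fin m → Fin 2) (n : ℕ) :
    blockCount x w n ≤ blockCount y w n + m * diffCount x y n := by
  let G : Fin m → Finset ℕ := fun k =>
    (Finset.range (n + 1)).filter fun i => i + m ≤ n ∧ x (i + k) ≠ y (i + k)
  have hG : ∀ k ∈ Finset.univ, (G k).card ≤ diffCount x y n := fun k _ => by
    refine Finset.card_le_card_of_injOn (fun i => i + k) (fun i hi => ?_) fun i _ j _ hij => by
      simpa using hij
    simp only [G, Finset.coe_filter, Finset.mem_range, Set.mem_ofPred_eq] at hi ⊢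
    exact ⟨by omega, hi.2.2⟩
  calc blockCount x w n ≤ (((Finset.range (n + 1)).filter
          (fun i => i + m ≤ n ∧ ∀ k : Fin m, y (i + k) = w k)) ∪ Finset.univ.biUnion G).card := by
        refine Finset.card_le_card fun i hi => ?_
        simp only [G, Finset.mem_filter, Finset.mem_union, Finset.mem_biUnion] at hi ⊢
        by_cases h : ∀ k : Fin m, y (i + k) = w k
        · exact .inl ⟨hi.1, hi.2.1, h⟩
        · push Not at h
          obtain ⟨k, hk⟩ := h
          exact .inr ⟨k, Finset.mem_univ k, hi.1, hi.2.1, by rw [hi.2.2 k]; exact hk.symm⟩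
    _ ≤ _ := by
      refine (Finset.card_union_le _ _).trans (Nat.add_le_add_left ?_ _)
      simpa using Finset.card_biUnion_le_card_mul Finset.univ G _ hG

theorem mem_normalSeq_of_diffCount {x y : ℕ → Fin 2} (hx : x ∈ normalSeq)
    (h : Tendsto (fun n : ℕ => (diffCount x y n : ℝ) / n) atTop (𝓝 0)) : y ∈ normalSeq := by
  intro m w
  refine (hx m w).congr_dist ?_
  have h1 := h.const_mul (m : ℝ)
  rw [mul_zero] at h1
  refine squeeze_zero (fun _ => dist_nonneg) (fun n => ?_) h1
  rw [Real.dist_eq, ← sub_div, abs_div, Nat.abs_cast, ← mul_div_assoc]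
  gcongr
  have h2 : (blockCount x w n : ℝ) ≤ blockCount y w n + m * diffCount x y n := by
    exact_mod_cast blockCount_le_add_diffCount x y w n
  have h3 : (blockCount y w n : ℝ) ≤ blockCount x w n + m * diffCount x y n := by
    rw [diffCount_comm]
    exact_mod_cast blockCount_le_add_diffCount y x w n
  exact abs_le.2 ⟨by linarith, by linarith⟩

end Perturbation

/-! ### The encoding map and the structure of its runs of ones. -/

section Encoding

/-- The length of the run of ones planted in the `n`-th dyadic stage. -/
def plantedRun (a : ℕ → ℕ) (n : ℕ) : ℕ := n + n / (a (2 * n + 1) + 1)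

/-- The digit at position `2 ^ n + r`, for `r < 2 ^ n`: first comes a run of ones of length
`plantedRun a n` between two zeros, then zeros up to a proportion of `1 / (a (2 * n) + 1)` of the
stage, and from then on the digits `d` of the base sequence, interrupted by zeros at the multiples
of `n + 1`. -/
def stageDigit (a : ℕ → ℕ) (n r : ℕ) (d : Fin 2) : Fin 2 :=
  if r < plantedRun a n + 2 then (if r = 0 ∨ r = plantedRun a n + 1 then 0 else 1)
  else if r * (a (2 * n) + 1) < 2 ^ n ∨ n + 1 ∣ r then 0 else d

/-- The modification of the base sequence `b` governed by `a`. -/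
def encode (b : ℕ → Fin 2) (a : ℕ → ℕ) (i : ℕ) : Fin 2 :=
  stageDigit a (Nat.log 2 i) (i - 2 ^ Nat.log 2 i) (b i)

variable {b : ℕ → Fin 2} {a : ℕ → ℕ}

theorem continuous_encode (b : ℕ → Fin 2) : Continuous (encode b) := by
  refine continuous_pi fun i => ?_
  set n := Nat.log 2 i with hn
  let F : ℕ × ℕ → Fin 2 := fun p =>
    stageDigit (fun k => if k = 2 * n then p.1 else p.2) n (i - 2 ^ n) (b i)
  have h : (fun a => encode b a i) = F ∘ fun a => (a (2 * n), a (2 * n + 1)) := by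
    ext1 a
    simp [F, encode, stageDigit, plantedRun, ← hn]
  rw [h]
  exact continuous_of_discreteTopology.comp (by fun_prop)

theorem encode_stage {n r : ℕ} (hr : r < 2 ^ n) :
    encode b a (2 ^ n + r) = stageDigit a n r (b (2 ^ n + r)) := by
  have : Nat.log 2 (2 ^ n + r) = n :=
    (Nat.log_eq_iff (.inr ⟨one_lt_two, by have := Nat.two_pow_pos n; omega⟩)).2
      ⟨by omega, by rw [pow_succ]; omega⟩
  rw [encode, this, Nat.add_sub_cancel_left]

theorem encode_two_pow (n : ℕ) : encode b a (2 ^ n) = 0 := by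
  have := encode_stage (b := b) (a := a) (r := 0) (Nat.two_pow_pos n)
  rw [add_zero] at this
  rw [this]
  simp [stageDigit]

/-- Position `0` lies in no stage; the conventions `Nat.log 2 0 = 0` and `0 - 1 = 0` give it the
leading zero of stage `0`. -/
theorem encode_zero : encode b a 0 = 0 := by simp [encode, stageDigit]

theorem le_plantedRun (a : ℕ → ℕ) (n : ℕ) : n ≤ plantedRun a n := Nat.le_add_right _ _

theorem plantedRun_le (a : ℕ → ℕ) (n : ℕ) : plantedRun a n ≤ 2 * n := by
  have := Nat.div_le_self n (a (2 * n + 1) + 1)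
  unfold plantedRun
  omega

theorem two_mul_add_one_le_two_pow {n : ℕ} (hn : 3 ≤ n) : 2 * n + 1 ≤ 2 ^ n := by
  induction n, hn using Nat.le_induction with
  | base => norm_num
  | succ n hn ih => rw [pow_succ]; omega

/-- Every run of ones lies in one stage, and is at most as long as the run planted there. -/
theorem exists_stage_of_run {i j : ℕ} (hj : 0 < j) (h : ∀ k < j, encode b a (i + k) = 1) :
    ∃ n, 2 ^ n ≤ i ∧ j ≤ plantedRun a n := by
  have hi : i ≠ 0 := by
    rintro rfl
    have := h 0 hj
    rw [add_zero, encode_zero] at this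
    exact absurd this (by decide)
  obtain ⟨n, r, hr, rfl⟩ : ∃ n r, r < 2 ^ n ∧ i = 2 ^ n + r := by
    refine ⟨Nat.log 2 i, i - 2 ^ Nat.log 2 i, ?_, ?_⟩
    · have := Nat.lt_pow_succ_log_self one_lt_two i
      rw [pow_succ] at this
      omega
    · have := Nat.pow_log_le_self 2 hi
      omega
  refine ⟨n, Nat.le_add_right _ _, ?_⟩
  -- A run cannot cross the zero that opens the next stage.
  have hend : r + j ≤ 2 ^ n := by
    by_contra! hcon
    have := h (2 ^ n - r) (by omega)
    rw [show 2 ^ n + r + (2 ^ n - r) = 2 ^ (n + 1) by rw [pow_succ]; omega,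
      encode_two_pow] at this
    exact absurd this (by decide)
  have hs : ∀ k < j, stageDigit a n (r + k) (b (2 ^ n + (r + k))) = 1 := fun k hk => by
    rw [← encode_stage (by omega), ← add_assoc]
    exact h k hk
  by_contra! hcon
  have hle := le_plantedRun a n
  -- A too long run starting in the planted segment would cover its closing zero; one starting later
  -- would cover a multiple of `n + 1`, the least one `≥ r` being `(n + 1) * ((r + n) / (n + 1))`.
  by_cases hrR : r < plantedRun a n + 2
  · have hr0 : r ≠ 0 := by
      rintro rfl
      have := hs 0 hj
      simp [stageDigit] at this
    have := hs (plantedRun a n + 1 - r) (by omega)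
    rw [show r + (plantedRun a n + 1 - r) = plantedRun a n + 1 by omega] at this
    simp [stageDigit] at this
  · have h1 := Nat.div_add_mod (r + n) (n + 1)
    have h2 : (r + n) % (n + 1) < n + 1 := Nat.mod_lt _ (by omega)
    have := hs ((n + 1) * ((r + n) / (n + 1)) - r) (by omega)
    rw [show r + ((n + 1) * ((r + n) / (n + 1)) - r) = (n + 1) * ((r + n) / (n + 1)) by omega,
      stageDigit, if_neg (by omega), if_pos (.inr (Nat.dvd_mul_right _ _))] at this
    exact absurd this (by decide)

theorem plantedRun_le_runLength {n : ℕ} (hn : 3 ≤ n) :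
    plantedRun a n ≤ runLength (2 ^ (n + 1)) (encode b a) := by
  have h1 := plantedRun_le a n
  have h2 := two_mul_add_one_le_two_pow hn
  refine le_runLength (i := 2 ^ n + 1) (by rw [pow_succ]; omega) fun k hk => ?_
  rw [add_assoc, encode_stage (by omega), stageDigit, if_pos (by omega), if_neg (by omega)]

end Encoding

/-! ### Typicality of the encoded sequence and the odd terms. -/

section Typical

variable {b : ℕ → Fin 2} {a : ℕ → ℕ}

theorem runLength_mono (x : ℕ → Fin 2) : Monotone fun n => runLength n x := fun _ _ h =>
  runLength_le fun _ _ hij hx => le_runLength (hij.trans h) hx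

theorem eventually_le_runLength_encode :
    ∀ᶠ N : ℕ in atTop, Real.logb 2 N - 2 ≤ runLength N (encode b a) := by
  filter_upwards [eventually_ge_atTop (2 ^ 4)] with N hN
  have hN0 : N ≠ 0 := by omega
  have hlog : 4 ≤ Nat.log 2 N := (Nat.le_log_iff_pow_le one_lt_two hN0).2 hN
  -- The stage of `N` may be cut off before its run ends, so the run of the previous stage `n` is
  -- used; as `N < 2 ^ (n + 2)`, this loses at most `2`.
  obtain ⟨n, hn⟩ : ∃ n, Nat.log 2 N = n + 1 := ⟨Nat.log 2 N - 1, by omega⟩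
  have h1 : 2 ^ (n + 1) ≤ N := hn ▸ Nat.pow_log_le_self 2 hN0
  have h2 : N < 2 ^ (n + 2) := by
    have := Nat.lt_pow_succ_log_self one_lt_two N
    rwa [hn] at this
  have h3 : n ≤ runLength N (encode b a) :=
    (le_plantedRun a n).trans ((plantedRun_le_runLength (by omega)).trans (runLength_mono _ h1))
  have h4 : Real.logb 2 N ≤ (n + 2 : ℕ) := by
    rw [Real.logb_le_iff_le_rpow one_lt_two (by exact_mod_cast Nat.pos_of_ne_zero hN0),
      Real.rpow_natCast]
    exact_mod_cast h2.le
  have h3' : (n : ℝ) ≤ runLength N (encode b a) := by exact_mod_cast h3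
  push_cast at h4
  linarith

/-- A stage `n` that meets the first `N` digits has `n ≤ log₂ N`; the term `2 * n₀` absorbs the runs
of the stages before `n₀`. -/
theorem runLength_encode_le {ε : ℝ} (hε : 0 ≤ ε) {n₀ : ℕ}
    (h : ∀ n ≥ n₀, (plantedRun a n : ℝ) ≤ (1 + ε) * n) {N : ℕ} (hN : 0 < N) :
    (runLength N (encode b a) : ℝ) ≤ (1 + ε) * Real.logb 2 N + 2 * n₀ := by
  have hlog : 0 ≤ Real.logb 2 N := Real.logb_nonneg one_lt_two (by exact_mod_cast hN)
  have hB : 0 ≤ (1 + ε) * Real.logb 2 N + 2 * n₀ := by positivity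
  rw [← Nat.le_floor_iff hB]
  refine runLength_le fun i j hij hj => ?_
  rw [Nat.le_floor_iff hB]
  rcases Nat.eq_zero_or_pos j with rfl | hj0
  · simpa using hB
  obtain ⟨n, hn, hjn⟩ := exists_stage_of_run hj0 hj
  have hjn' : (j : ℝ) ≤ plantedRun a n := by exact_mod_cast hjn
  refine hjn'.trans ?_
  rcases lt_or_ge n n₀ with hlt | hge
  · have h1 : (plantedRun a n : ℝ) ≤ 2 * n₀ := by
      exact_mod_cast (plantedRun_le a n).trans (by omega)
    have : 0 ≤ (1 + ε) * Real.logb 2 N := by positivity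
    linarith
  · have h1 : (n : ℝ) ≤ Real.logb 2 N := by
      rw [Real.le_logb_iff_rpow_le one_lt_two (by exact_mod_cast hN), Real.rpow_natCast]
      exact_mod_cast (by omega : 2 ^ n ≤ N)
    have h2 : (1 + ε) * n ≤ (1 + ε) * Real.logb 2 N := by gcongr
    have h3 : (0 : ℝ) ≤ 2 * n₀ := by positivity
    linarith [h n hge]

theorem encode_mem_typicalSeq (ha : a ∈ oddDivergent) : encode b a ∈ typicalSeq := by
  refine tendsto_order.2 ⟨fun c hc => ?_, fun c hc => ?_⟩
  · have h1 : Tendsto (fun N : ℕ => 1 - 2 / Real.logb 2 (N : ℝ)) atTop (𝓝 (1 - 0)) :=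
      tendsto_const_nhds.sub (tendsto_const_nhds.div_atTop tendsto_logb_natCast_atTop)
    rw [sub_zero] at h1
    filter_upwards [h1.eventually_const_lt hc, eventually_le_runLength_encode (b := b) (a := a),
      tendsto_logb_natCast_atTop.eventually_gt_atTop 0] with N hN1 hN2 hN3
    refine hN1.trans_le ?_
    rw [one_sub_div hN3.ne']
    gcongr
  · obtain ⟨ε, hε, hεc⟩ : ∃ ε : ℝ, 0 < ε ∧ 1 + ε < c :=
      ⟨(c - 1) / 2, by linarith, by linarith⟩
    obtain ⟨q, hq⟩ := exists_nat_one_div_lt hε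
    have ha' : Tendsto (fun n => a (2 * n + 1)) atTop atTop := ha
    obtain ⟨n₀, hn₀⟩ := eventually_atTop.1 (ha'.eventually_ge_atTop q)
    have hR : ∀ n ≥ n₀, (plantedRun a n : ℝ) ≤ (1 + ε) * n := fun n hn => by
      have h1 : (q : ℝ) ≤ a (2 * n + 1) := by exact_mod_cast hn₀ n hn
      have h2 : ((n / (a (2 * n + 1) + 1) : ℕ) : ℝ) ≤ ε * n := by
        refine Nat.cast_div_le.trans ?_
        push_cast
        rw [div_eq_mul_one_div, mul_comm]
        gcongr
        refine le_trans ?_ hq.le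
        gcongr
      unfold plantedRun
      push_cast at h2 ⊢
      linarith
    have h1 : Tendsto (fun N : ℕ => 1 + ε + 2 * n₀ / Real.logb 2 (N : ℝ)) atTop
        (𝓝 (1 + ε + 0)) :=
      tendsto_const_nhds.add (tendsto_const_nhds.div_atTop tendsto_logb_natCast_atTop)
    rw [add_zero] at h1
    filter_upwards [h1.eventually_lt_const hεc, eventually_gt_atTop 0,
      tendsto_logb_natCast_atTop.eventually_gt_atTop 0] with N hN1 hN2 hN3
    refine lt_of_le_of_lt ?_ hN1
    rw [div_le_iff₀ hN3, add_mul, div_mul_cancel₀ _ hN3.ne']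
    exact runLength_encode_le hε.le hR hN2

/-- If `a (2 * n + 1) < c` infinitely often, then at those `n` the first `2 ^ (n + 1)` digits
eventually contain a run of length at least `n + n / c`, and the ratio stays near or above `1 + 1 /
c`. -/
theorem mem_oddDivergent_of_encode (h : encode b a ∈ typicalSeq) : a ∈ oddDivergent := by
  by_contra ha
  obtain ⟨c, hc⟩ : ∃ c, ¬ ∀ᶠ n in atTop, c ≤ a (2 * n + 1) := by
    by_contra! hcon
    exact ha (tendsto_atTop.2 hcon)
  have hfreq : ∃ᶠ n in atTop, a (2 * n + 1) < c := by
    simpa only [Filter.not_eventually, not_le] using hc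
  have hc0 : 0 < c := by
    obtain ⟨n, hn⟩ := hfreq.exists
    omega
  have hc0' : (0 : ℝ) < c := by exact_mod_cast hc0
  have hpow : Tendsto (fun n : ℕ => 2 ^ (n + 1)) atTop atTop :=
    (tendsto_pow_atTop_atTop_of_one_lt one_lt_two).comp (tendsto_add_atTop_nat 1)
  have h1 : Tendsto (fun n : ℕ => (runLength (2 ^ (n + 1)) (encode b a) : ℝ) / (n + 1)) atTop
      (𝓝 1) := by
    refine (Tendsto.comp h hpow).congr fun n => ?_
    simp only [Function.comp_apply]
    congr 1
    push_cast
    rw [Real.logb_pow, Real.logb_self_eq_one one_lt_two]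
    push_cast
    ring
  -- This is `(n + n / c - 1) / (n + 1)` with real division; the `-1` pays for the floor in `n / c`.
  have h2 : Tendsto (fun n : ℕ => (1 + 1 / (c : ℝ)) - (2 + 1 / c) * (1 / ((n : ℝ) + 1))) atTop
      (𝓝 ((1 + 1 / (c : ℝ)) - (2 + 1 / c) * 0)) :=
    tendsto_const_nhds.sub (tendsto_const_nhds.mul tendsto_one_div_add_atTop_nhds_zero_nat)
  have hlt : (1 : ℝ) < (1 + 1 / (c : ℝ)) - (2 + 1 / c) * 0 := by
    have : 0 < 1 / (c : ℝ) := by positivity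
    linarith
  obtain ⟨n, hn, hn1, hn3⟩ :=
    (hfreq.and_eventually ((h1.eventually_lt h2 hlt).and (eventually_ge_atTop 3))).exists
  have hle : plantedRun a n ≤ runLength (2 ^ (n + 1)) (encode b a) := plantedRun_le_runLength hn3
  have h4 : n + n / c ≤ plantedRun a n :=
    Nat.add_le_add_left (Nat.div_le_div_left hn (Nat.succ_pos _)) _
  have h5 : (n : ℝ) + (n / c : ℕ) ≤ runLength (2 ^ (n + 1)) (encode b a) := by
    exact_mod_cast h4.trans hle
  have h6 : (n : ℝ) / c ≤ (n / c : ℕ) + 1 := by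
    rw [div_le_iff₀ hc0']
    have h6 := (Nat.lt_div_mul_add hc0 : n < n / c * c + c)
    rw [← Nat.succ_mul] at h6
    exact_mod_cast h6.le
  have hpos : (0 : ℝ) < (n : ℝ) + 1 := by positivity
  rw [div_lt_iff₀ hpos] at hn1
  have h7 : (1 + 1 / (c : ℝ) - (2 + 1 / c) * (1 / ((n : ℝ) + 1))) * (n + 1) =
      n + n / c - 1 := by
    field_simp
    ring
  linarith

theorem encode_mem_typicalSeq_iff : encode b a ∈ typicalSeq ↔ a ∈ oddDivergent :=
  ⟨mem_oddDivergent_of_encode, encode_mem_typicalSeq⟩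

end Typical

/-! ### Normality of the encoded sequence and the even terms. -/

section Normal

variable {b : ℕ → Fin 2} {a : ℕ → ℕ}

/-- The number of digits of the `n`-th dyadic stage that are changed by `encode`. -/
def stageDiff (b : ℕ → Fin 2) (a : ℕ → ℕ) (n : ℕ) : ℕ :=
  ((Finset.range (2 ^ n)).filter fun r => b (2 ^ n + r) ≠ encode b a (2 ^ n + r)).card

/-- The three terms bound the planted run with its two zeros, the initial stretch of zeros, and the
multiples of `n + 1`. -/
theorem stageDiff_le (b : ℕ → Fin 2) (a : ℕ → ℕ) (n : ℕ) :
    stageDiff b a n ≤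
      (2 * n + 2) + (2 ^ n / (a (2 * n) + 1) + 1) + (2 ^ n / (n + 1) + 1) := by
  calc stageDiff b a n ≤ ((Finset.range (2 * n + 2) ∪
        Finset.range (2 ^ n / (a (2 * n) + 1) + 1)) ∪
        (Finset.range (2 ^ n / (n + 1) + 1)).image (· * (n + 1))).card := by
        refine Finset.card_le_card fun r hr => ?_
        rw [Finset.mem_filter, Finset.mem_range] at hr
        obtain ⟨hr, hne⟩ := hr
        rw [encode_stage hr, stageDigit] at hne
        simp only [Finset.mem_union, Finset.mem_range, Finset.mem_image]
        split_ifs at hne with h1 h2 h3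
        · exact .inl (.inl (by have := plantedRun_le a n; omega))
        · exact .inl (.inl (by have := plantedRun_le a n; omega))
        · rcases h3 with h3 | ⟨q, rfl⟩
          · left
            right
            rw [Nat.lt_succ_iff, Nat.le_div_iff_mul_le (Nat.succ_pos _)]
            exact h3.le
          · right
            refine ⟨q, ?_, mul_comm _ _⟩
            rw [Nat.lt_succ_iff, Nat.le_div_iff_mul_le (Nat.succ_pos _), mul_comm]
            exact hr.le
        · exact absurd rfl hne
    _ ≤ _ := by
      refine (Finset.card_union_le _ _).trans (Nat.add_le_add ?_ ?_)
      · exact (Finset.card_union_le _ _).trans (by simp)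
      · exact Finset.card_image_le.trans (by simp)

theorem card_filter_range_add (p : ℕ → Prop) [DecidablePred p] (m K : ℕ) :
    ((Finset.range (m + K)).filter p).card =
      ((Finset.range m).filter p).card + ((Finset.range K).filter fun r => p (m + r)).card := by
  simp only [Finset.card_filter, Finset.sum_range_add]

/-- The summand `1` is for position `0`, outside every stage. -/
theorem diffCount_two_pow_le (b : ℕ → Fin 2) (a : ℕ → ℕ) (M : ℕ) :
    diffCount b (encode b a) (2 ^ M) ≤ 1 + ∑ n ∈ Finset.range M, stageDiff b a n := by
  induction M with
  | zero => exact (Finset.card_filter_le _ _).trans (by simp)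
  | succ M ih =>
    rw [Finset.sum_range_succ, pow_succ, mul_two, diffCount, card_filter_range_add]
    unfold diffCount at ih
    unfold stageDiff at ih ⊢
    omega

theorem tendsto_linear_div_two_pow (c d : ℝ) :
    Tendsto (fun n : ℕ => (c * n + d) / 2 ^ n) atTop (𝓝 0) := by
  have h1 := (tendsto_pow_const_div_const_pow_of_one_lt 1 (one_lt_two (α := ℝ))).const_mul c
  have h2 := (tendsto_pow_const_div_const_pow_of_one_lt 0 (one_lt_two (α := ℝ))).const_mul d
  have h3 := h1.add h2
  rw [mul_zero, mul_zero, add_zero] at h3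
  refine h3.congr fun n => ?_
  rw [pow_one, pow_zero]
  ring

theorem tendsto_stageDiff (ha : a ∈ evenDivergent) :
    Tendsto (fun n => (stageDiff b a n : ℝ) / 2 ^ n) atTop (𝓝 0) := by
  have h1 : Tendsto (fun n => 1 / ((a (2 * n) : ℝ) + 1)) atTop (𝓝 0) :=
    tendsto_one_div_add_atTop_nhds_zero_nat.comp ha
  have h2 := ((tendsto_linear_div_two_pow 2 4).add h1).add
    (tendsto_one_div_add_atTop_nhds_zero_nat (𝕜 := ℝ))
  simp only [add_zero] at h2
  refine squeeze_zero (fun n => by positivity) (fun n => ?_) h2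
  have hp : (0 : ℝ) < 2 ^ n := by positivity
  have h3 : (stageDiff b a n : ℝ) ≤ (2 * n + 2) + (((2 ^ n / (a (2 * n) + 1) : ℕ) : ℝ) + 1) +
      (((2 ^ n / (n + 1) : ℕ) : ℝ) + 1) := by exact_mod_cast stageDiff_le b a n
  have h4 : ((2 ^ n / (a (2 * n) + 1) : ℕ) : ℝ) ≤ 2 ^ n / (a (2 * n) + 1) := by
    simpa using Nat.cast_div_le (α := ℝ) (m := 2 ^ n) (n := a (2 * n) + 1)
  have h5 : ((2 ^ n / (n + 1) : ℕ) : ℝ) ≤ 2 ^ n / (n + 1) := by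
    simpa using Nat.cast_div_le (α := ℝ) (m := 2 ^ n) (n := n + 1)
  rw [div_le_iff₀ hp]
  calc _ ≤ (2 * n + 4) + 2 ^ n / ((a (2 * n) : ℝ) + 1) + 2 ^ n / ((n : ℝ) + 1) := by linarith
    _ = _ := by field_simp

theorem tendsto_diffCount (ha : a ∈ evenDivergent) :
    Tendsto (fun N : ℕ => (diffCount b (encode b a) N : ℝ) / N) atTop (𝓝 0) := by
  have hgeom : ∀ M : ℕ, ∑ n ∈ Finset.range M, (2 : ℝ) ^ n = 2 ^ M - 1 := fun M => by
    rw [geom_sum_eq (by norm_num)]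
    norm_num
  have hlo : (fun n => (stageDiff b a n : ℝ)) =o[atTop] fun n => (2 : ℝ) ^ n :=
    (Asymptotics.isLittleO_iff_tendsto' (.of_forall fun n hn =>
      absurd hn (by positivity))).2 (tendsto_stageDiff ha)
  have hsum := hlo.sum_range (fun n => pow_nonneg zero_le_two n) (by
    simp_rw [hgeom]
    exact tendsto_atTop_add_const_right _ _ (tendsto_pow_atTop_atTop_of_one_lt one_lt_two))
  simp_rw [hgeom] at hsum
  have hsum' : (fun M => ∑ n ∈ Finset.range M, (stageDiff b a n : ℝ)) =o[atTop]
      fun M => (2 : ℝ) ^ M := by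
    refine hsum.trans_isBigO (Asymptotics.IsBigO.of_bound 1 (.of_forall fun M => ?_))
    have h1 : (1 : ℝ) ≤ 2 ^ M := one_le_pow₀ one_le_two
    rw [Real.norm_eq_abs, Real.norm_eq_abs, abs_of_nonneg (by linarith), abs_of_nonneg (by linarith)]
    linarith
  -- The factor `2` is the cost of passing from `N` to the next power of two.
  have h1 := ((tendsto_linear_div_two_pow 0 1).add hsum'.tendsto_div_nhds_zero).const_mul 2
  rw [add_zero, mul_zero] at h1
  have hlog : Tendsto (fun N : ℕ => Nat.log 2 N + 1) atTop atTop := by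
    refine tendsto_atTop.2 fun c => ?_
    filter_upwards [eventually_ge_atTop (2 ^ c)] with N hN
    exact Nat.le_succ_of_le <| (Nat.le_log_iff_pow_le one_lt_two
      (by have := Nat.two_pow_pos c; omega)).2 hN
  refine squeeze_zero' (.of_forall fun N => by positivity) ?_ (h1.comp hlog)
  filter_upwards [eventually_gt_atTop 0] with N hN
  have h2 := Nat.pow_log_le_self 2 hN.ne'
  have h3 := Nat.lt_pow_succ_log_self one_lt_two N
  simp only [Function.comp_apply]
  generalize Nat.log 2 N = M at *
  have h4 : (diffCount b (encode b a) N : ℝ) ≤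
      1 + ∑ n ∈ Finset.range (M + 1), (stageDiff b a n : ℝ) := by
    exact_mod_cast (diffCount_mono _ _ h3.le).trans (diffCount_two_pow_le b a (M + 1))
  have h5 : (2 : ℝ) ^ M ≤ N := by exact_mod_cast h2
  calc _ ≤ (1 + ∑ n ∈ Finset.range (M + 1), (stageDiff b a n : ℝ)) / 2 ^ M := by gcongr
    _ = _ := by
      rw [pow_succ]
      field_simp
      ring

theorem encode_mem_normalSeq (hb : b ∈ normalSeq) (ha : a ∈ evenDivergent) :
    encode b a ∈ normalSeq :=
  mem_normalSeq_of_diffCount hb (tendsto_diffCount ha)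

/-- The number of ones grows slowly along the zeros planted in a dyadic stage. -/
theorem card_ones_encode_le {n c : ℕ} (hc : a (2 * n) < c) :
    ((Finset.range (2 ^ n + 2 ^ n / c)).filter fun i => encode b a i = 1).card ≤
      ((Finset.range (2 ^ n)).filter fun i => encode b a i = 1).card + (2 * n + 2) := by
  rw [card_filter_range_add]
  refine Nat.add_le_add_left ?_ _
  rw [← Finset.card_range (2 * n + 2)]
  refine Finset.card_le_card fun r hr => ?_
  rw [Finset.mem_filter, Finset.mem_range] at hr
  obtain ⟨hr, h1⟩ := hr
  rw [Finset.mem_range]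
  by_contra! hcon
  have hR := plantedRun_le a n
  rw [encode_stage (hr.trans_le (Nat.div_le_self _ _)), stageDigit, if_neg (by omega),
    if_pos] at h1
  · exact absurd h1 (by decide)
  · left
    have h2 : (r + 1) * c ≤ 2 ^ n := (Nat.le_div_iff_mul_le (by omega)).1 hr
    have h3 : r * (a (2 * n) + 1) ≤ r * c := Nat.mul_le_mul_left r hc
    rw [add_mul] at h2
    omega

/-- If `a (2 * n) < c` infinitely often, then at those `n` almost no ones are gained between `2 ^ n`
and `2 ^ n + 2 ^ n / c`. Both lengths should show a frequency of ones near `1 / 2`, yet the second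
is longer by a factor near `1 + 1 / c`. -/
theorem mem_evenDivergent_of_encode (h : encode b a ∈ normalSeq) : a ∈ evenDivergent := by
  by_contra ha
  obtain ⟨c, hc⟩ : ∃ c, ¬ ∀ᶠ n in atTop, c ≤ a (2 * n) := by
    by_contra! hcon
    exact ha (tendsto_atTop.2 hcon)
  have hfreq : ∃ᶠ n in atTop, a (2 * n) < c := by
    simpa only [Filter.not_eventually, not_le] using hc
  have hc0 : 0 < c := by
    obtain ⟨n, hn⟩ := hfreq.exists
    omega
  have hc0' : (0 : ℝ) < c := by exact_mod_cast hc0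
  have hone := h 1 fun _ => 1
  simp only [blockCount_const_one, pow_one] at hone
  set S : ℕ → ℕ := fun n => ((Finset.range n).filter fun i => encode b a i = 1).card
  have hone : Tendsto (fun n : ℕ => (S n : ℝ) / n) atTop (𝓝 (1 / 2)) := hone
  have hpow : Tendsto (fun n : ℕ => 2 ^ n) atTop atTop :=
    tendsto_pow_atTop_atTop_of_one_lt one_lt_two
  have hpow' : Tendsto (fun n : ℕ => 2 ^ n + 2 ^ n / c) atTop atTop :=
    tendsto_atTop_mono (fun n => Nat.le_add_right _ _) hpow
  have h1 : Tendsto (fun n : ℕ => (S (2 ^ n) : ℝ) / 2 ^ n) atTop (𝓝 (1 / 2)) := by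
    refine (hone.comp hpow).congr fun n => ?_
    simp
  -- A lower bound for the ratio of the two lengths, with `1 / 2 ^ n` paying for the floor in `2 ^ n
  -- / c`.
  have hratio : Tendsto (fun n : ℕ => 1 + 1 / (c : ℝ) - 1 / 2 ^ n) atTop
      (𝓝 (1 + 1 / (c : ℝ) - 0)) :=
    tendsto_const_nhds.sub (by simpa using tendsto_linear_div_two_pow 0 1)
  have h2 := (hone.comp hpow').mul hratio
  have h3 := h1.add (tendsto_linear_div_two_pow 2 2)
  have hlt : (1 : ℝ) / 2 + 0 < 1 / 2 * (1 + 1 / (c : ℝ) - 0) := by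
    have : 0 < 1 / (c : ℝ) := by positivity
    linarith
  obtain ⟨n, hn, hn'⟩ := (hfreq.and_eventually (h3.eventually_lt h2 hlt)).exists
  have h4 : (S (2 ^ n + 2 ^ n / c) : ℝ) ≤ S (2 ^ n) + (2 * n + 2) := by
    exact_mod_cast card_ones_encode_le hn
  simp only [Function.comp_apply] at hn'
  have hp : (0 : ℝ) < 2 ^ n := by positivity
  have h5 : (2 : ℝ) ^ n / c ≤ (2 ^ n / c : ℕ) + 1 := by
    rw [div_le_iff₀ hc0']
    have h6 := (Nat.lt_div_mul_add hc0 : 2 ^ n < 2 ^ n / c * c + c)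
    rw [← Nat.succ_mul] at h6
    exact_mod_cast h6.le
  push_cast at hn'
  rw [← add_div] at hn'
  refine absurd hn' (not_lt.2 ?_)
  have hden : (0 : ℝ) < 2 ^ n + (2 ^ n / c : ℕ) := by positivity
  calc (S (2 ^ n + 2 ^ n / c) : ℝ) / (2 ^ n + (2 ^ n / c : ℕ)) * (1 + 1 / (c : ℝ) - 1 / 2 ^ n)
      ≤ (S (2 ^ n + 2 ^ n / c) : ℝ) / (2 ^ n + (2 ^ n / c : ℕ)) *
          ((2 ^ n + (2 ^ n / c : ℕ)) / 2 ^ n) := by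
        gcongr
        rw [le_div_iff₀ hp]
        have : (1 + 1 / (c : ℝ) - 1 / 2 ^ n) * 2 ^ n = 2 ^ n + 2 ^ n / c - 1 := by
          field_simp
        linarith
    _ = (S (2 ^ n + 2 ^ n / c) : ℝ) / 2 ^ n := by field_simp
    _ ≤ _ := by gcongr

theorem encode_mem_normalSeq_iff (hb : b ∈ normalSeq) :
    encode b a ∈ normalSeq ↔ a ∈ evenDivergent :=
  ⟨mem_evenDivergent_of_encode, encode_mem_normalSeq hb⟩

end Normal

/-! ### Completeness of the differences and the final assembly. -/

section Completeness

variable {X : Type*} [TopologicalSpace X] {S T : Set X}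

/-- A pair of `Π⁰₃` sets to which the pair `evenDivergent`, `oddDivergent` reduces simultaneously
has a complete difference. -/
theorem isD2Pi0Complete_sdiff (hS : IsPi0 3 S) (hT : IsPi0 3 T) {φ : (ℕ → ℕ) → X}
    (hφ : Continuous φ) (hφS : φ ⁻¹' S = evenDivergent) (hφT : φ ⁻¹' T = oddDivergent) :
    IsD2Pi0Complete 3 (S \ T) ∧ IsD2Pi0Complete 3 (T \ S) := by
  constructor
  · refine IsD2Pi0Complete.of_hard ⟨S, T, hS, hT, rfl⟩ fun Z _ _ hZ B hB => ?_
    obtain ⟨P, Q, hP, hQ, rfl⟩ := hB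
    obtain ⟨f, hf, hfP, hfQ⟩ := exists_continuous_preimage_divergent hZ hP hQ
    refine ⟨φ ∘ f, hφ.comp hf, ?_⟩
    rw [Set.preimage_comp, Set.preimage_sdiff, Set.preimage_sdiff, hφS, hφT, hfP, hfQ]
  · refine IsD2Pi0Complete.of_hard ⟨T, S, hT, hS, rfl⟩ fun Z _ _ hZ B hB => ?_
    obtain ⟨P, Q, hP, hQ, rfl⟩ := hB
    obtain ⟨f, hf, hfQ, hfP⟩ := exists_continuous_preimage_divergent hZ hQ hP
    refine ⟨φ ∘ f, hφ.comp hf, ?_⟩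
    rw [Set.preimage_comp, Set.preimage_sdiff, Set.preimage_sdiff, hφS, hφT, hfP, hfQ]

theorem nonempty_evenDivergent_sdiff : (evenDivergent \ oddDivergent).Nonempty := by
  refine ⟨fun n => if n % 2 = 0 then n else 0, ?_, fun h => ?_⟩
  · simp only [evenDivergent, Set.mem_ofPred_eq, Nat.mul_mod_right, if_true]
    exact tendsto_atTop_mono (fun n => by simp only [id]; omega) tendsto_id
  · simp only [oddDivergent, Set.mem_ofPred_eq, Nat.mul_add_mod, Nat.one_mod, one_ne_zero,
      if_false] at h
    exact not_tendsto_const_atTop _ _ h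

theorem nonempty_oddDivergent_sdiff : (oddDivergent \ evenDivergent).Nonempty := by
  refine ⟨fun n => if n % 2 = 0 then 0 else n, ?_, fun h => ?_⟩
  · simp only [oddDivergent, Set.mem_ofPred_eq, Nat.mul_add_mod, Nat.one_mod, one_ne_zero,
      if_false]
    exact tendsto_atTop_mono (fun n => by simp only [id]; omega) tendsto_id
  · simp only [evenDivergent, Set.mem_ofPred_eq, Nat.mul_mod_right, if_true] at h
    exact not_tendsto_const_atTop _ _ h

end Completeness

end TypicalNumbers

theorem theoremB :
    (TypicalNumbers.TpcN \ TypicalNumbers.Normal).Nonempty ∧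
    (TypicalNumbers.Normal \ TypicalNumbers.TpcN).Nonempty ∧
    TypicalNumbers.IsD2Pi0Complete 3 (TypicalNumbers.TpcN \ TypicalNumbers.Normal) ∧
    TypicalNumbers.IsD2Pi0Complete 3 (TypicalNumbers.Normal \ TypicalNumbers.TpcN) ∧
    TypicalNumbers.IsD2Pi0Complete 3 (TypicalNumbers.typicalSeq \ TypicalNumbers.normalSeq) ∧
    TypicalNumbers.IsD2Pi0Complete 3 (TypicalNumbers.normalSeq \ TypicalNumbers.typicalSeq) ∧
    ∃ φ : (ℕ → ℕ) → (ℕ → Fin 2), Continuous φ ∧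
      φ ⁻¹' (TypicalNumbers.normalSeq \ TypicalNumbers.typicalSeq) =
        TypicalNumbers.evenDivergent \ TypicalNumbers.oddDivergent ∧
      φ ⁻¹' (TypicalNumbers.typicalSeq \ TypicalNumbers.normalSeq) =
        TypicalNumbers.oddDivergent \ TypicalNumbers.evenDivergent := by
  open TypicalNumbers in
  obtain ⟨b, hb⟩ := nonempty_normalSeq
  have hN : encode b ⁻¹' normalSeq = evenDivergent :=
    Set.ext fun _ => encode_mem_normalSeq_iff hb
  have hT : encode b ⁻¹' typicalSeq = oddDivergent :=
    Set.ext fun _ => encode_mem_typicalSeq_iff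
  have hN' : (toUnit ∘ encode b) ⁻¹' Normal = evenDivergent := by
    rw [Set.preimage_comp, normal_eq_image, toUnit_preimage_image disjoint_normalSeq, hN]
  have hT' : (toUnit ∘ encode b) ⁻¹' TpcN = oddDivergent := by
    rw [Set.preimage_comp, tpcN_eq_image, toUnit_preimage_image disjoint_typicalSeq, hT]
  have hseq := isD2Pi0Complete_sdiff isPi0_normalSeq isPi0_typicalSeq (continuous_encode b) hN hT
  have hnum := isD2Pi0Complete_sdiff (S := Normal) (T := TpcN)
    (normal_eq_image ▸ isPi0_toUnit_image disjoint_normalSeq isPi0_normalSeq)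
    (tpcN_eq_image ▸ isPi0_toUnit_image disjoint_typicalSeq isPi0_typicalSeq)
    (continuous_toUnit.comp (continuous_encode b)) hN' hT'
  refine ⟨?_, ?_, hnum.2, hnum.1, hseq.2, hseq.1, encode b, continuous_encode b, ?_, ?_⟩
  · refine Set.nonempty_of_nonempty_preimage (f := toUnit ∘ encode b) ?_
    rw [Set.preimage_sdiff, hN', hT']
    exact nonempty_oddDivergent_sdiff
  · refine Set.nonempty_of_nonempty_preimage (f := toUnit ∘ encode b) ?_
    rw [Set.preimage_sdiff, hN', hT']
    exact nonempty_evenDivergent_sdiff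
  · rw [Set.preimage_sdiff, hN, hT]
  · rw [Set.preimage_sdiff, hN, hT]
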